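/- Let $m\ge 2$ be an integer and let $c_1,c_2:\mathbb{R}\to\mathbb{R}$ be smooth ($C^\infty$) functions with $c_1(t)<c_2(t)$ for all $t\in\mathbb{R}$. Put $D=\{(x_1,x_2)\in\mathbb{R}^2 : c_1(x_2)<x_1<c_2(x_2)\}$ and let $$X=\Bigl\{(x_1,x_2,y_1,\dots,y_{m-1})\in\overline{D}\times\mathbb{R}^{m-1} : (x_1-c_1(x_2))(c_2(x_2)-x_1)-\sum_{j=1}^{m-1}y_j^2=0\Bigr\}\subset\mathbb{R}^{m+1},$$ which is an $m$-dimensional smooth submanifold without boundary. Let $\pi:X\to\mathbb{R}$ be the restriction to $X$ of the projection $(x_1,x_2,y)\mapsto x_1$. A contour of $\pi$ is a connected component of a level set of $\pi$; it is called critical if it contains a critical point of $\pi$. The Reeb space $R_\pi$ is the set of all contours of $\pi$, with the quotient topology from $X$. Write $S(c_i)=\{t : c_i'(t)=0\}$. A graph with ends is a connected Hausdorff space $R$ with a set $V\subset R$ of vertices such that $R\setminus V$ is non-empty, every connected component (edge) of $R\setminus V$ is homeomorphic to $\mathbb{R}$ and has closure homeomorphic to $[-1,1]$ or to the ray $[0,\infty)$,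 and $R$ carries the weak topology with respect to the closures of its edges. It is a graph (without ends) if the closure of every edge is homeomorphic to $[-1,1]$. Isomorphisms are homeomorphisms mapping the vertex set onto the vertex set. Suppose that $c_1(S(c_1))\cup c_2(S(c_2))$ is a discrete and closed subset of $\mathbb{R}$, that at least one of $c_1,c_2$ has a critical point, and that, as $t\to-\infty$, either both $c_1(t)$ and $c_2(t)$ tend to $+\infty$ or both tend to $-\infty$, and likewise (independently) as $t\to+\infty$. Then $\pi$ is proper, and $R_\pi$, with the set of all critical contours as vertex set, is a graph with ends (the Reeb graph of $\pi$). Moreover, the Reeb graph is isomorphic to a graph (without ends) if and only if $S(c_1)\cup S(c_2)$ is unbounded both below and above. -/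

import Mathlib

open Set Filter Topology
open scoped ContDiff

namespace Reeb

/-! ### Reeb spaces -/

/-- The contour of `f` through `x`: the connected component of `x` in its level set. -/
def contour {X : Type*} [TopologicalSpace X] (f : X → ℝ) (x : X) : Set X :=
  connectedComponentIn (f ⁻¹' {f x}) x

/-- Two points are equivalent when they lie in the same contour of `f`. -/
def contourSetoid {X : Type*} [TopologicalSpace X] (f : X → ℝ) : Setoid X :=
  Setoid.ker (contour f)

/-- The Reeb space of `f`, which carries the quotient topology. -/
abbrev ReebSpace {X : Type*} [TopologicalSpace X] (f : X → ℝ) : Type _ :=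
  Quotient (contourSetoid f)

/-- The quotient map onto the Reeb space. -/
def quotientMap {X : Type*} [TopologicalSpace X] (f : X → ℝ) (x : X) : ReebSpace f :=
  Quotient.mk (contourSetoid f) x

/-! ### Graphs, with or without ends -/

/-- The edges (open `1`-cells) of a `1`-dimensional complex `R` with vertex set `V`: the connected
components of the complement of `V`. -/
def edges {R : Type*} [TopologicalSpace R] (V : Set R) : Set (Set R) :=
  {e | ∃ x ∈ Vᶜ, e = connectedComponentIn Vᶜ x}

/-- `R` is a graph with ends whose vertex set is `V`: a connected Hausdorff space with at least
one edge, in which every edge is an open `1`-cell whose closure is homeomorphic to the closed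
interval `[-1, 1]` or to the ray `[0, ∞)`, and which has the weak topology with respect to the
closures of its edges.

(It follows that `V` is closed and discrete, that edges are open, and that the closure of an edge
consists of the edge and one or two vertices.) -/
structure IsGraphWithEnds (R : Type*) [TopologicalSpace R] (V : Set R) : Prop where
  t2 : T2Space R
  connected : ConnectedSpace R
  exists_edge : (edges V).Nonempty
  edge_homeo : ∀ e ∈ edges V, Nonempty (e ≃ₜ ℝ)
  closure_edge : ∀ e ∈ edges V,
    Nonempty (closure e ≃ₜ Icc (-1 : ℝ) 1) ∨ Nonempty (closure e ≃ₜ Ici (0 : ℝ))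
  weak_topology : ∀ A : Set R, (∀ e ∈ edges V, IsClosed (A ∩ closure e)) → IsClosed A

/-- `R` is a graph (without ends) whose vertex set is `V`: the closure of every edge is
homeomorphic to `[-1, 1]`. -/
def IsGraph (R : Type*) [TopologicalSpace R] (V : Set R) : Prop :=
  IsGraphWithEnds R V ∧ ∀ e ∈ edges V, Nonempty (closure e ≃ₜ Icc (-1 : ℝ) 1)

/-- The graph with ends `(R, V)` is isomorphic to some graph (without ends), where isomorphisms
are the homeomorphisms that map the vertex set onto the vertex set. -/
def IsIsomorphicToGraph (R : Type) [TopologicalSpace R] (V : Set R) : Prop :=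
  ∃ (G : Type) (_ : TopologicalSpace G) (W : Set G),
    IsGraph G W ∧ ∃ h : R ≃ₜ G, h '' V = W

/-! ### Critical points -/

/-- The critical set `S(c)` of a smooth function `c : ℝ → ℝ`. -/
def criticalSet (c : ℝ → ℝ) : Set ℝ := {t | deriv c t = 0}

/-- `p` is a critical point of the restriction of the smooth function `f` to the submanifold `M`
(without boundary) of the ambient space `E`: the differential of `f` at `p` vanishes on all tangent
vectors of `M` at `p`, that is, on the velocities of smooth curves in `M` through `p`. -/
def IsCriticalPointOn {E : Type*} [NormedAddCommGroup E] [NormedSpace ℝ E]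
    (M : Set E) (f : E → ℝ) (p : E) : Prop :=
  p ∈ M ∧ ∀ (ε : ℝ) (γ : ℝ → E), 0 < ε → ContDiffOn ℝ ∞ γ (Ioo (-ε) ε) →
    (∀ t ∈ Ioo (-ε) ε, γ t ∈ M) → γ 0 = p → deriv (fun t => f (γ t)) 0 = 0

/-- The points of the Reeb space of `f` restricted to `M` that are critical contours, that is,
contours containing a critical point. -/
def criticalContours {E : Type*} [NormedAddCommGroup E] [NormedSpace ℝ E]
    (M : Set E) (f : E → ℝ) : Set (ReebSpace (M.domRestrict f)) :=
  {r | ∃ x : M, IsCriticalPointOn M f x ∧ quotientMap (M.domRestrict f) x = r}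

/-! ### The manifold over the region between two graphs -/

/-- The open region between the graphs of `c₁` and `c₂`; the graphs are taken over the second
coordinate axis. -/
def region (c₁ c₂ : ℝ → ℝ) : Set (ℝ × ℝ) := {x | c₁ x.2 < x.1 ∧ x.1 < c₂ x.2}

/-- The space `ℝ^{m+1} = ℝ² × ℝ^{m-1}` (for `1 ≤ m`). -/
abbrev Ambient (m : ℕ) : Type := (ℝ × ℝ) × EuclideanSpace ℝ (Fin (m - 1))

/-- The manifold `X_{m, c₁, c₂}`, as a subset of `ℝ^{m+1}`. -/
def manifoldX (m : ℕ) (c₁ c₂ : ℝ → ℝ) : Set (Ambient m) :=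
  {p | p.1 ∈ closure (region c₁ c₂) ∧
    (p.1.1 - c₁ p.1.2) * (c₂ p.1.2 - p.1.1) - ∑ j, (p.2 j) ^ 2 = 0}

/-- The projection of `ℝ^{m+1}` to its first coordinate. -/
def proj (m : ℕ) (p : Ambient m) : ℝ := p.1.1

end Reeb

/-! Over an interior point of the closed strip between the two graphs the fibre of `X` is a sphere
of dimension `m - 2`; over a boundary point it is a single point. A component of a slice `{t | c₁ t
≤ x ≤ c₂ t}` is a compact interval with ends on the boundary, so the part of `X` over it is
connected even for `m = 2`, where the two sheets meet at the ends. Thus contours correspond to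
components of slices (`quotientMap_eq_iff`), the critical points of the projection lie exactly over
the boundary points where `c₁' = 0` or `c₂' = 0`, and the Reeb space is a quotient of the strip
(`isContourMap`).

Both functions tend to the same infinity at each end, so bounded levels involve only bounded
parameters; this gives properness. A gap in a slice forces a critical point of `c₁` above the level
or of `c₂` below it (`exists_critical_of_gap`). Critical values being isolated, the slices near a
noncritical contour have a single component there. Hence the induced height on the Reeb space is
proper with finite fibres and is a local homeomorphism off the vertices (`IsHeight`). Any such
height embeds the closure of each edge as a closed interval of the line, and the edges are locally
finite, which yields a graph with ends.

An edge closes up to an arc exactly when its height is bounded. If the critical parameters are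
bounded on one side, the boundary curve far out on that side stays in one edge of unbounded height.
If they are unbounded on both sides, an edge of unbounded height would sweep across a critical
parameter and so contain a vertex (`false_of_unbounded`). -/

namespace Reeb

/-! ### Open intervals of the real line -/

/-- A nonempty open connected subset of the line is an open interval. -/
theorem eq_openInterval {J : Set ℝ} (ho : IsOpen J) (hc : IsPreconnected J) (hn : J.Nonempty) :
    (∃ a b, a < b ∧ J = Ioo a b) ∨ (∃ a, J = Ioi a) ∨ (∃ b, J = Iio b) ∨ J = univ := by
  have hIoo : ∀ a b, J = Ioo a b → ∃ a b, a < b ∧ J = Ioo a b := fun a b h =>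
    ⟨a, b, nonempty_Ioo.1 (h ▸ hn), h⟩
  have hi := ho.interior_eq
  rcases hc.mem_intervals with h | h | h | h | h | h | h | h | h | h
  · exact .inl (hIoo _ _ (by rw [← interior_Icc, ← h, hi]))
  · exact .inl (hIoo _ _ (by rw [← interior_Ico, ← h, hi]))
  · exact .inl (hIoo _ _ (by rw [← interior_Ioc, ← h, hi]))
  · exact .inl (hIoo _ _ h)
  · exact .inr (.inl ⟨sInf J, by rw [← interior_Ici, ← h, hi]⟩)
  · exact .inr (.inl ⟨_, h⟩)
  · exact .inr (.inr (.inl ⟨sSup J, by rw [← interior_Iic, ← h, hi]⟩))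
  · exact .inr (.inr (.inl ⟨_, h⟩))
  · exact .inr (.inr (.inr h))
  · exact absurd h hn.ne_empty

/-- A nonempty bounded open interval is homeomorphic to the line. -/
theorem nonempty_homeomorph_Ioo {a b : ℝ} (h : a < b) : Nonempty (Ioo a b ≃ₜ ℝ) := by
  have hba : (0 : ℝ) < (b - a) / 2 := by linarith
  have e₁ : Ioo (-1 : ℝ) 1 ≃ₜ Ioo a b :=
    (affineHomeomorph ((b - a) / 2) ((a + b) / 2) hba.ne').sets (by
      ext x
      simp only [mem_Ioo, mem_preimage, affineHomeomorph_apply]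
      constructor
      · rintro ⟨h1, h2⟩
        constructor <;> nlinarith
      · rintro ⟨h1, h2⟩
        constructor <;> nlinarith)
  exact ⟨e₁.symm.trans (orderIsoIooNegOneOne ℝ).symm.toHomeomorph⟩

/-- An open ray is homeomorphic to the line. -/
theorem nonempty_homeomorph_Ioi (a : ℝ) : Nonempty (Ioi a ≃ₜ ℝ) := by
  have e₁ : Ioi a ≃ₜ Ioi (0 : ℝ) := (Homeomorph.subRight a).sets (by ext x; simp)
  exact ⟨e₁.trans Real.expOrderIso.symm.toHomeomorph⟩

theorem nonempty_homeomorph_real {J : Set ℝ} (ho : IsOpen J) (hc : IsPreconnected J)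
    (hn : J.Nonempty) : Nonempty (J ≃ₜ ℝ) := by
  rcases eq_openInterval ho hc hn with ⟨a, b, hab, rfl⟩ | ⟨a, rfl⟩ | ⟨b, rfl⟩ | rfl
  · exact nonempty_homeomorph_Ioo hab
  · exact nonempty_homeomorph_Ioi a
  · have e₁ : Iio b ≃ₜ Ioi (-b) := (Homeomorph.neg ℝ).sets (by ext x; simp)
    obtain ⟨e₂⟩ := nonempty_homeomorph_Ioi (-b)
    exact ⟨e₁.trans e₂⟩
  · exact ⟨Homeomorph.Set.univ ℝ⟩

/-- The closure of a bounded open interval is homeomorphic to `[-1, 1]`. -/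
theorem nonempty_homeomorph_closure_of_bdd {J : Set ℝ} (ho : IsOpen J) (hc : IsPreconnected J)
    (hn : J.Nonempty) (hb : BddBelow J) (ha : BddAbove J) :
    Nonempty (closure J ≃ₜ Icc (-1 : ℝ) 1) := by
  rcases eq_openInterval ho hc hn with ⟨a, b, hab, rfl⟩ | ⟨a, rfl⟩ | ⟨b, rfl⟩ | rfl
  · rw [closure_Ioo hab.ne]
    exact ⟨(iccHomeoI a b hab).trans (iccHomeoI (-1 : ℝ) 1 (by norm_num)).symm⟩
  · exact absurd ha (not_bddAbove_Ioi a)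
  · exact absurd hb (not_bddBelow_Iio b)
  · exact absurd ha not_bddAbove_univ

/-- The closure of a proper open interval is homeomorphic to `[-1, 1]` or to `[0, ∞)`. -/
theorem nonempty_homeomorph_closure {J : Set ℝ} (ho : IsOpen J) (hc : IsPreconnected J)
    (hn : J.Nonempty) (hu : J ≠ univ) :
    Nonempty (closure J ≃ₜ Icc (-1 : ℝ) 1) ∨ Nonempty (closure J ≃ₜ Ici (0 : ℝ)) := by
  rcases eq_openInterval ho hc hn with ⟨a, b, hab, rfl⟩ | ⟨a, rfl⟩ | ⟨b, rfl⟩ | rfl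
  · exact .inl (nonempty_homeomorph_closure_of_bdd ho hc hn bddBelow_Ioo bddAbove_Ioo)
  · rw [closure_Ioi]
    exact .inr ⟨(Homeomorph.subRight a).sets (by ext x; simp)⟩
  · rw [closure_Iio]
    exact .inr ⟨(Homeomorph.subLeft b).sets (by ext x; simp)⟩
  · exact absurd rfl hu

/-! ### Spaces with a height function -/

/-- `h` is a height function on `R` with vertex set `V`: it is proper with finite fibres, the
levels of the vertices are isolated, and `h` is a local homeomorphism away from `V`. -/
structure IsHeight {R : Type*} [TopologicalSpace R] (V : Set R) (h : R → ℝ) : Prop where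
  proper : IsProperMap h
  finite_fiber : ∀ a, (h ⁻¹' {a}).Finite
  isolated : ∀ a, ∃ δ > 0, ∀ v ∈ V, h v ∈ Ioo (a - δ) (a + δ) → h v = a
  chart : ∀ r ∉ V, ∃ U, IsOpen U ∧ r ∈ U ∧ IsPreconnected U ∧ U ⊆ Vᶜ ∧ InjOn h U ∧
    ∀ W ⊆ U, IsOpen W → IsOpen (h '' W)

namespace IsHeight

variable {R : Type*} [TopologicalSpace R] {V : Set R} {h : R → ℝ}

theorem isOpen_compl (H : IsHeight V h) : IsOpen Vᶜ := by
  refine isOpen_iff_mem_nhds.2 fun r hr => ?_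
  obtain ⟨U, hU, hrU, -, hUV, -⟩ := H.chart r hr
  exact mem_of_superset (hU.mem_nhds hrU) hUV

theorem isOpen_image (H : IsHeight V h) {W : Set R} (hW : IsOpen W) (hWV : W ⊆ Vᶜ) :
    IsOpen (h '' W) := by
  refine isOpen_iff_mem_nhds.2 ?_
  rintro _ ⟨r, hr, rfl⟩
  obtain ⟨U, hU, hrU, -, -, -, hop⟩ := H.chart r (hWV hr)
  exact mem_of_superset ((hop (W ∩ U) inter_subset_right (hW.inter hU)).mem_nhds
    (mem_image_of_mem h ⟨hr, hrU⟩)) (image_mono inter_subset_left)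

/-- Two local inverses of `h` on intervals that agree somewhere agree on the common domain. -/
theorem eq_of_image_eq [T2Space R] (H : IsHeight V h) {U U' : Set R} (hU : IsOpen U)
    (hU' : IsOpen U')
    (hc : IsPreconnected U) (hc' : IsPreconnected U') (hUV : U ⊆ Vᶜ) (hUV' : U' ⊆ Vᶜ)
    (hi : InjOn h U) (hi' : InjOn h U') (hm : (U ∩ U').Nonempty) {x y : R} (hx : x ∈ U)
    (hy : y ∈ U') (hxy : h x = h y) : x = y := by
  have hcont := H.proper.continuous
  obtain ⟨z, hz⟩ := hm
  have hJ : IsPreconnected (h '' U ∩ h '' U') :=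
    ((hc.image h hcont.continuousOn).ordConnected.inter
      (hc'.image h hcont.continuousOn).ordConnected).isPreconnected
  -- The levels at which the two inverses agree form an open set, also relatively closed in the
  -- common interval because `R` is Hausdorff.
  have hsub : h '' U ∩ h '' U' ⊆ h '' (U ∩ U') := by
    refine hJ.subset_of_closure_inter_subset
      (H.isOpen_image (hU.inter hU') (inter_subset_left.trans hUV))
      ⟨h z, ⟨⟨z, hz.1, rfl⟩, ⟨z, hz.2, rfl⟩⟩, ⟨z, hz, rfl⟩⟩ ?_
    rintro b ⟨hb, ⟨u, hu, rfl⟩, ⟨u', hu', huu⟩⟩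
    by_cases he : u = u'
    · exact ⟨u, ⟨hu, he ▸ hu'⟩, rfl⟩
    obtain ⟨A, A', hA, hA', huA, huA', hd⟩ := t2_separation he
    have hN : IsOpen (h '' (A ∩ U) ∩ h '' (A' ∩ U')) :=
      (H.isOpen_image (hA.inter hU) (inter_subset_right.trans hUV)).inter
        (H.isOpen_image (hA'.inter hU') (inter_subset_right.trans hUV'))
    obtain ⟨_, ⟨⟨v, hv, rfl⟩, ⟨v', hv', hvv'⟩⟩, ⟨w, hw, hvw⟩⟩ :=
      mem_closure_iff.1 hb _ hN ⟨⟨u, ⟨huA, hu⟩, rfl⟩, ⟨u', ⟨huA', hu'⟩, huu⟩⟩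
    have h1 : w = v := hi hw.1 hv.2 hvw
    have h2 : w = v' := hi' hw.2 hv'.2 (hvw.trans hvv'.symm)
    exact (disjoint_left.1 hd (h1 ▸ hv.1 : w ∈ A) (h2 ▸ hv'.1)).elim
  obtain ⟨w, hw, hwx⟩ := hsub ⟨⟨x, hx, rfl⟩, ⟨y, hy, hxy.symm⟩⟩
  rw [← hi hw.1 hx hwx, ← hi' hw.2 hy (hwx.trans hxy)]

/-- A component of the complement of `V` is open and `h` is injective on it. -/
theorem isOpen_and_injOn_component [T2Space R] (H : IsHeight V h) {r : R} (hr : r ∉ V) :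
    IsOpen (connectedComponentIn Vᶜ r) ∧ InjOn h (connectedComponentIn Vᶜ r) := by
  -- Any two members share `r`, so by `eq_of_image_eq` the union is again a member. A chart at a
  -- limit point enlarges it, so the union exhausts the component.
  set 𝒰 : Set (Set R) := {U | IsOpen U ∧ IsPreconnected U ∧ r ∈ U ∧ U ⊆ Vᶜ ∧ InjOn h U}
  have hinj : InjOn h (⋃₀ 𝒰) := by
    rintro x ⟨U, ⟨hU, hc, hrU, hUV, hi⟩, hx⟩ y ⟨U', ⟨hU', hc', hrU', hUV', hi'⟩, hy⟩ hxy
    exact H.eq_of_image_eq hU hU' hc hc' hUV hUV' hi hi' ⟨r, hrU, hrU'⟩ hx hy hxy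
  have hop : IsOpen (⋃₀ 𝒰) := isOpen_sUnion fun U hU => hU.1
  have hpc : IsPreconnected (⋃₀ 𝒰) :=
    isPreconnected_sUnion r _ (fun U hU => hU.2.2.1) (fun U hU => hU.2.1)
  have hsV : ⋃₀ 𝒰 ⊆ Vᶜ := sUnion_subset fun U hU => hU.2.2.2.1
  have hrm : r ∈ ⋃₀ 𝒰 := by
    obtain ⟨U, hU, hrU, hc, hUV, hi, -⟩ := H.chart r hr
    exact ⟨U, ⟨hU, hc, hrU, hUV, hi⟩, hrU⟩
  have heq : connectedComponentIn Vᶜ r = ⋃₀ 𝒰 := by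
    refine Subset.antisymm ?_ (hpc.subset_connectedComponentIn hrm hsV)
    refine isPreconnected_connectedComponentIn.subset_of_closure_inter_subset hop
      ⟨r, mem_connectedComponentIn hr, hrm⟩ ?_
    rintro s ⟨hs, hs'⟩
    obtain ⟨N, hN, hsN, hNc, hNV, hNi, -⟩ := H.chart s (connectedComponentIn_subset _ _ hs')
    obtain ⟨z, hzN, hz⟩ := mem_closure_iff.1 hs N hN hsN
    refine ⟨⋃₀ 𝒰 ∪ N, ⟨hop.union hN, hpc.union z hz hzN hNc, .inl hrm, union_subset hsV hNV, ?_⟩,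
      .inr hsN⟩
    have key : ∀ x ∈ ⋃₀ 𝒰, ∀ y ∈ N, h x = h y → x = y := fun x hx y hy hxy =>
      H.eq_of_image_eq hop hN hpc hNc hsV hNV hinj hNi ⟨z, hz, hzN⟩ hx hy hxy
    rintro x (hx | hx) y (hy | hy) hxy
    · exact hinj hx hy hxy
    · exact key x hx y hy hxy
    · exact (key y hy x hx hxy.symm).symm
    · exact hNi hx hy hxy
  rw [heq]
  exact ⟨hop, hinj⟩

/-! ### Edges and their closures under a height function -/

theorem subset_compl {e : Set R} (he : e ∈ edges V) : e ⊆ Vᶜ := by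
  obtain ⟨r, hr, rfl⟩ := he
  exact connectedComponentIn_subset _ _

theorem isPreconnected_edge {e : Set R} (he : e ∈ edges V) : IsPreconnected e := by
  obtain ⟨r, hr, rfl⟩ := he
  exact isPreconnected_connectedComponentIn

theorem nonempty_edge {e : Set R} (he : e ∈ edges V) : e.Nonempty := by
  obtain ⟨r, hr, rfl⟩ := he
  exact ⟨r, mem_connectedComponentIn hr⟩

theorem eq_component {e : Set R} (he : e ∈ edges V) {s : R} (hs : s ∈ e) :
    e = connectedComponentIn Vᶜ s := by
  obtain ⟨r, hr, rfl⟩ := he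
  exact connectedComponentIn_eq hs

/-- Adding limit points to a connected set keeps it connected, and a component is maximal. -/
theorem closure_inter_compl_subset {e : Set R} (he : e ∈ edges V) : closure e ∩ Vᶜ ⊆ e := by
  obtain ⟨r, hr, rfl⟩ := he
  refine IsPreconnected.subset_connectedComponentIn
    (isPreconnected_connectedComponentIn.subset_closure
      (subset_inter subset_closure (connectedComponentIn_subset _ _)) inter_subset_left)
    ⟨subset_closure (mem_connectedComponentIn hr), hr⟩ inter_subset_right

theorem isOpen_edge [T2Space R] (H : IsHeight V h) {e : Set R} (he : e ∈ edges V) :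
    IsOpen e := by
  obtain ⟨r, hr, rfl⟩ := he
  exact (H.isOpen_and_injOn_component hr).1

theorem injOn_edge [T2Space R] (H : IsHeight V h) {e : Set R} (he : e ∈ edges V) :
    InjOn h e := by
  obtain ⟨r, hr, rfl⟩ := he
  exact (H.isOpen_and_injOn_component hr).2

theorem isPreconnected_image_edge (H : IsHeight V h) {e : Set R} (he : e ∈ edges V) :
    IsPreconnected (h '' e) :=
  (isPreconnected_edge he).image h H.proper.continuous.continuousOn

theorem isOpen_image_edge [T2Space R] (H : IsHeight V h) {e : Set R} (he : e ∈ edges V) :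
    IsOpen (h '' e) :=
  H.isOpen_image (H.isOpen_edge he) (subset_compl he)

theorem isOpenEmbedding_edge [T2Space R] (H : IsHeight V h) {e : Set R} (he : e ∈ edges V) :
    IsOpenEmbedding (fun x : e => h x) := by
  refine .of_continuous_injective_isOpenMap (H.proper.continuous.comp continuous_subtype_val)
    (fun x y hxy => Subtype.ext (H.injOn_edge he x.2 y.2 hxy)) fun W hW => ?_
  have : (fun x : e => h x) '' W = h '' (Subtype.val '' W) := by rw [image_image]
  rw [this]
  refine H.isOpen_image ((H.isOpen_edge he).isOpenMap_subtype_val W hW) ?_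
  rintro _ ⟨x, -, rfl⟩
  exact subset_compl he x.2

theorem isPreconnected_edge_inter [T2Space R] (H : IsHeight V h) {e : Set R} (he : e ∈ edges V)
    {Q : Set ℝ} (hQ : Q.OrdConnected) : IsPreconnected (e ∩ h ⁻¹' Q) := by
  have hr : range (fun x : e => h x) = h '' e := by
    ext; simp
  have h1 : IsPreconnected (h '' e ∩ Q) :=
    ((H.isPreconnected_image_edge he).ordConnected.inter hQ).isPreconnected
  have h2 := (h1.preimage_of_isOpenMap (H.isOpenEmbedding_edge he).injective
    (H.isOpenEmbedding_edge he).isOpenMap (by rw [hr]; exact inter_subset_left)).image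
    Subtype.val continuous_subtype_val.continuousOn
  convert h2 using 1
  ext x
  constructor
  · rintro ⟨hx, hx'⟩
    exact ⟨⟨x, hx⟩, ⟨⟨x, hx, rfl⟩, hx'⟩, rfl⟩
  · rintro ⟨⟨y, hy⟩, hy', rfl⟩
    exact ⟨hy, hy'.2⟩

/-- Two limit points at one level `b` could be separated by open sets covering the finite fibre over
`b`, hence, as `h` is closed, all fibres nearby. The part of the edge over a small interval around
`b` is connected, yet it would meet both sets. -/
theorem injOn_closure_edge [T2Space R] (H : IsHeight V h) {e : Set R} (he : e ∈ edges V) :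
    InjOn h (closure e) := by
  intro z hz w hw hzw
  by_contra hne
  set b := h z with hb
  have hfin := H.finite_fiber b
  obtain ⟨O, O', hO, hO', hzO, hOf, hd⟩ : SeparatedNhds {z} (h ⁻¹' {b} \ {z}) :=
    .of_isCompact_isCompact isCompact_singleton (hfin.subset sdiff_subset).isCompact
      disjoint_sdiff_right
  have hzO : z ∈ O := hzO rfl
  have hwO : w ∈ O' := hOf ⟨hzw.symm, fun h => hne h.symm⟩
  have hev : ∀ᶠ y in 𝓝 b, ∀ x ∈ h ⁻¹' {y}, x ∈ O ∪ O' := by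
    refine H.proper.isClosedMap.eventually_nhds_fiber b fun x hx => ?_
    by_cases hxz : x = z
    · exact (hO.union hO').mem_nhds (.inl (hxz ▸ hzO))
    · exact (hO.union hO').mem_nhds (.inr (hOf ⟨hx, hxz⟩))
  obtain ⟨ε, hε, hball⟩ := Metric.eventually_nhds_iff_ball.1 hev
  rw [Real.ball_eq_Ioo] at hball
  set Q := Ioo (b - ε) (b + ε)
  have hbQ : b ∈ Q := ⟨by linarith, by linarith⟩
  have hT := H.isPreconnected_edge_inter he (Q := Q) ordConnected_Ioo
  have hQo : IsOpen (h ⁻¹' Q) := isOpen_Ioo.preimage H.proper.continuous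
  have hTs : e ∩ h ⁻¹' Q ⊆ O ∪ O' := fun x hx => hball (h x) hx.2 x rfl
  obtain ⟨x, ⟨hxO, hxQ⟩, hxe⟩ := mem_closure_iff.1 hz _ (hO.inter hQo) ⟨hzO, hbQ⟩
  obtain ⟨y, ⟨hyO, hyQ⟩, hye⟩ := mem_closure_iff.1 hw _ (hO'.inter hQo)
    ⟨hwO, show h w ∈ Q from hzw ▸ hbQ⟩
  have := hT.subset_left_of_subset_union hO hO' hd hTs ⟨x, ⟨hxe, hxQ⟩, hxO⟩ ⟨hye, hyQ⟩
  exact disjoint_left.1 hd this hyO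

theorem closure_image_edge (H : IsHeight V h) (e : Set R) :
    closure (h '' e) = h '' closure e :=
  H.proper.isClosedMap.closure_image_eq_of_continuous H.proper.continuous e

theorem nonempty_homeomorph_closure_edge [T2Space R] (H : IsHeight V h) {e : Set R}
    (he : e ∈ edges V) : Nonempty (closure e ≃ₜ closure (h '' e)) := by
  have hemb : IsClosedEmbedding (fun x : closure e => h x) :=
    .of_continuous_injective_isClosedMap (H.proper.continuous.comp continuous_subtype_val)
      (fun x y hxy => Subtype.ext (H.injOn_closure_edge he x.2 y.2 hxy))
      (H.proper.isClosedMap.comp isClosed_closure.isClosedMap_subtype_val)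
  refine ⟨hemb.isEmbedding.toHomeomorph.trans (Homeomorph.setCongr ?_)⟩
  rw [H.closure_image_edge]
  ext; simp

/-- Over the image interval of an edge, the edge is closed. -/
theorem closure_inter_preimage_subset [T2Space R] (H : IsHeight V h) {e : Set R}
    (he : e ∈ edges V) : closure e ∩ h ⁻¹' (h '' e) ⊆ e := by
  rintro x ⟨hx, y, hy, hyx⟩
  rwa [← H.injOn_closure_edge he (subset_closure hy) hx hyx]

/-- An edge is closed over its own image. Were the image the whole line, the edge would be clopen,
leaving no room for a vertex. -/
theorem image_edge_ne_univ [T2Space R] [ConnectedSpace R] (H : IsHeight V h) (hV : V.Nonempty)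
    {e : Set R} (he : e ∈ edges V) : h '' e ≠ univ := by
  intro hu
  have hcl : IsClosed e := by
    refine isClosed_of_closure_subset fun x hx => H.closure_inter_preimage_subset he ⟨hx, ?_⟩
    rw [hu]; trivial
  have := IsClopen.eq_univ ⟨hcl, H.isOpen_edge he⟩ (nonempty_edge he)
  obtain ⟨v, hv⟩ := hV
  exact subset_compl he (this ▸ mem_univ v) hv

/-- An interval of levels without vertices that meets the image of an edge is contained in it. -/
theorem subset_image_edge [T2Space R] (H : IsHeight V h) {e : Set R} (he : e ∈ edges V)
    {Q : Set ℝ} (hQ : IsPreconnected Q) (hQV : ∀ v ∈ V, h v ∉ Q) (hm : (Q ∩ h '' e).Nonempty) :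
    Q ⊆ h '' e := by
  refine hQ.subset_of_closure_inter_subset (H.isOpen_image_edge he) hm ?_
  rw [H.closure_image_edge]
  rintro _ ⟨⟨z, hz, rfl⟩, hzQ⟩
  exact ⟨z, closure_inter_compl_subset he ⟨hz, fun hzV => hQV z hzV hzQ⟩, rfl⟩

/-- This is local finiteness: within `δ` of the level `a`, vertices occur only at `a`, so an edge
with a point at another level there must also cross `a - δ / 2` or `a + δ / 2`. Both fibres are
finite. -/
theorem weak_topology [T2Space R] (H : IsHeight V h) {A : Set R}
    (hA : ∀ e ∈ edges V, IsClosed (A ∩ closure e)) : IsClosed A := by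
  rw [← isOpen_compl_iff]
  refine isOpen_iff_mem_nhds.2 fun r hr => ?_
  set a := h r
  obtain ⟨δ, hδ, hiso⟩ := H.isolated a
  set E : Set (Set R) :=
    connectedComponentIn Vᶜ '' ((h ⁻¹' {a - δ / 2} ∪ h ⁻¹' {a + δ / 2}) ∩ Vᶜ)
  have hEfin : E.Finite :=
    (((H.finite_fiber _).union (H.finite_fiber _)).subset inter_subset_left).image _
  have hEe : E ⊆ edges V := by
    rintro _ ⟨x, hx, rfl⟩
    exact ⟨x, hx.2, rfl⟩
  set C := (h ⁻¹' {a} ∩ A) ∪ ⋃ e ∈ E, A ∩ closure e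
  have hC : IsClosed C := ((H.finite_fiber a).subset inter_subset_left).isClosed.union
    (hEfin.isClosed_biUnion fun e he => hA e (hEe he))
  have hCA : C ⊆ A := union_subset inter_subset_right (iUnion₂_subset fun _ _ => inter_subset_left)
  have hN : IsOpen (h ⁻¹' Ioo (a - δ) (a + δ)) := isOpen_Ioo.preimage H.proper.continuous
  refine mem_of_superset ((hN.inter hC.isOpen_compl).mem_nhds
    ⟨⟨by linarith, by linarith⟩, fun hrC => hr (hCA hrC)⟩) ?_
  rintro x ⟨hxN, hxC⟩ hxA
  refine hxC ?_
  by_cases hxa : h x = a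
  · exact .inl ⟨hxa, hxA⟩
  have hxV : x ∉ V := fun hxV => hxa (hiso x hxV hxN)
  set e := connectedComponentIn Vᶜ x
  have he : e ∈ edges V := ⟨x, hxV, rfl⟩
  have hxe : x ∈ e := mem_connectedComponentIn hxV
  suffices heE : e ∈ E from .inr (mem_biUnion heE ⟨hxA, subset_closure hxe⟩)
  have key : ∀ b, b = a - δ / 2 ∨ b = a + δ / 2 → b ∈ h '' e → e ∈ E := by
    rintro b hb ⟨y, hy, rfl⟩
    exact ⟨y, ⟨hb, subset_compl he hy⟩, (eq_component he hy).symm⟩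
  rcases lt_or_gt_of_ne hxa with hlt | hgt
  · refine key _ (.inl rfl) (H.subset_image_edge he (Q := Ioo (a - δ) a) isPreconnected_Ioo ?_
      ⟨h x, ⟨hxN.1, hlt⟩, ⟨x, hxe, rfl⟩⟩ ⟨by linarith, by linarith⟩)
    exact fun v hv hvQ => hvQ.2.ne (hiso v hv ⟨hvQ.1, hvQ.2.trans (by linarith)⟩)
  · refine key _ (.inr rfl) (H.subset_image_edge he (Q := Ioo a (a + δ)) isPreconnected_Ioo ?_
      ⟨h x, ⟨hgt, hxN.2⟩, ⟨x, hxe, rfl⟩⟩ ⟨by linarith, by linarith⟩)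
    exact fun v hv hvQ => hvQ.1.ne' (hiso v hv ⟨by linarith [hvQ.1], hvQ.2⟩)

/-- If every point were a vertex, isolation of vertex levels would make each level set clopen. -/
theorem exists_notMem [ConnectedSpace R] (H : IsHeight V h)
    (hne : ∃ r s, h r ≠ h s) : ∃ r, r ∉ V := by
  by_contra! hall
  obtain ⟨r, s, hrs⟩ := hne
  obtain ⟨δ, hδ, hiso⟩ := H.isolated (h r)
  have hcl : IsClosed (h ⁻¹' {h r}) := isClosed_singleton.preimage H.proper.continuous
  have hop : h ⁻¹' {h r} = h ⁻¹' Ioo (h r - δ) (h r + δ) := by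
    ext x
    refine ⟨fun hx => ?_, fun hx => hiso x (hall x) hx⟩
    rw [mem_preimage, mem_singleton_iff.1 hx]
    exact ⟨by linarith, by linarith⟩
  have hu := IsClopen.eq_univ ⟨hcl, hop ▸ isOpen_Ioo.preimage H.proper.continuous⟩ ⟨r, rfl⟩
  have hs : s ∈ h ⁻¹' {h r} := hu ▸ mem_univ s
  exact hrs (mem_singleton_iff.1 hs).symm

/-- A connected Hausdorff space with a nonconstant height function is a graph with ends. -/
theorem isGraphWithEnds [T2Space R] [ConnectedSpace R] (H : IsHeight V h) (hV : V.Nonempty)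
    (hne : ∃ r s, h r ≠ h s) : IsGraphWithEnds R V where
  t2 := inferInstance
  connected := inferInstance
  exists_edge := by
    obtain ⟨r, hr⟩ := H.exists_notMem hne
    exact ⟨_, r, hr, rfl⟩
  edge_homeo e he := by
    obtain ⟨φ⟩ := nonempty_homeomorph_real (H.isOpen_image_edge he)
      (H.isPreconnected_image_edge he) ((nonempty_edge he).image h)
    refine ⟨((H.isOpenEmbedding_edge he).isEmbedding.toHomeomorph.trans
      (Homeomorph.setCongr ?_)).trans φ⟩
    ext; simp
  closure_edge e he := by
    obtain ⟨ψ⟩ := H.nonempty_homeomorph_closure_edge he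
    exact (nonempty_homeomorph_closure (H.isOpen_image_edge he)
      (H.isPreconnected_image_edge he) ((nonempty_edge he).image h)
      (H.image_edge_ne_univ hV he)).imp (fun ⟨φ⟩ => ⟨ψ.trans φ⟩) (fun ⟨φ⟩ => ⟨ψ.trans φ⟩)
  weak_topology A hA := H.weak_topology hA

/-- The closure of an edge is an arc exactly when the edge has bounded height. -/
theorem nonempty_homeomorph_Icc_iff [T2Space R] (H : IsHeight V h) {e : Set R}
    (he : e ∈ edges V) :
    Nonempty (closure e ≃ₜ Icc (-1 : ℝ) 1) ↔ BddBelow (h '' e) ∧ BddAbove (h '' e) := by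
  constructor
  · rintro ⟨φ⟩
    have : CompactSpace (closure e) := φ.symm.compactSpace
    have hc : IsCompact (h '' closure e) :=
      (isCompact_iff_compactSpace.2 this).image H.proper.continuous
    exact ⟨hc.bddBelow.mono (image_mono subset_closure),
      hc.bddAbove.mono (image_mono subset_closure)⟩
  · rintro ⟨hb, ha⟩
    obtain ⟨ψ⟩ := H.nonempty_homeomorph_closure_edge he
    obtain ⟨φ⟩ := nonempty_homeomorph_closure_of_bdd (H.isOpen_image_edge he)
      (H.isPreconnected_image_edge he) ((nonempty_edge he).image h) hb ha
    exact ⟨ψ.trans φ⟩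

end IsHeight

/-- Being isomorphic to a graph without ends only depends on the closures of the edges. -/
theorem isIsomorphicToGraph_iff {R : Type} [TopologicalSpace R] {V : Set R}
    (hR : IsGraphWithEnds R V) :
    IsIsomorphicToGraph R V ↔ ∀ e ∈ edges V, Nonempty (closure e ≃ₜ Icc (-1 : ℝ) 1) := by
  constructor
  · rintro ⟨G, _, W, hG, φ, rfl⟩ _ ⟨r, hr, rfl⟩
    obtain ⟨ψ⟩ := hG.2 _ ⟨φ r, by simpa using hr, rfl⟩
    refine ⟨((φ.image _).trans (Homeomorph.setCongr ?_)).trans ψ⟩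
    rw [φ.image_closure, φ.image_connectedComponentIn hr, φ.image_compl]
  · intro h
    exact ⟨R, _, V, ⟨hR, h⟩, Homeomorph.refl R, by simp⟩

end Reeb

namespace Reeb

/-! ### The closed strip between two graphs -/

/-- The closed region between the graphs of `c₁` and `c₂`. -/
def strip (c₁ c₂ : ℝ → ℝ) : Set (ℝ × ℝ) := {z | c₁ z.2 ≤ z.1 ∧ z.1 ≤ c₂ z.2}

/-- The slice of the closed strip at level `x`. -/
def slice (c₁ c₂ : ℝ → ℝ) (x : ℝ) : Set ℝ := {t | c₁ t ≤ x ∧ x ≤ c₂ t}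

/-- The standing assumptions on the two functions: they are smooth and ordered, the strip escapes
from every bounded range of levels, and critical values are isolated. -/
structure IsAdmissible (c₁ c₂ : ℝ → ℝ) : Prop where
  smooth₁ : ContDiff ℝ ∞ c₁
  smooth₂ : ContDiff ℝ ∞ c₂
  lt : ∀ t, c₁ t < c₂ t
  escape : ∀ M, ∀ᶠ t in cocompact ℝ, M < c₁ t ∨ c₂ t < -M
  isolated : ∀ a, ∃ δ > 0, ∀ y ∈ c₁ '' criticalSet c₁ ∪ c₂ '' criticalSet c₂,
    y ∈ Ioo (a - δ) (a + δ) → y = a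

/-- `t` is a critical point of `c₁` or of `c₂` with value `x`. -/
def IsCriticalAt (c₁ c₂ : ℝ → ℝ) (x t : ℝ) : Prop :=
  (t ∈ criticalSet c₁ ∧ c₁ t = x) ∨ (t ∈ criticalSet c₂ ∧ c₂ t = x)

section Line

/-- If some point to the left of `t ∈ L` is not in the closed set `L`, then `t` can be joined to
such a point within a given neighbourhood `O` of `L`. -/
theorem exists_lt_notMem {L O : Set ℝ} (hL : IsClosed L) (hO : IsOpen O) (hLO : L ⊆ O) {t : ℝ}
    (ht : t ∈ L) (hb : ∃ s ≤ t, s ∉ L) : ∃ p < t, p ∉ L ∧ Icc p t ⊆ O := by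
  set S := {s | s ≤ t ∧ s ∉ L}
  have hSne : S.Nonempty := hb
  have hSb : BddAbove S := ⟨t, fun s hs => hs.1⟩
  -- The left end of the component of `L` containing `t`; points outside `L` accumulate at it from
  -- the left.
  set α := sSup S
  have hαt : α ≤ t := csSup_le hSne fun s hs => hs.1
  have hIoc : Ioc α t ⊆ L := fun s hs => by
    by_contra hsL
    exact (le_csSup hSb ⟨hs.2, hsL⟩).not_gt hs.1
  have hαL : α ∈ L := by
    rcases hαt.eq_or_lt with h | h
    · rwa [h]
    · have : α ∈ closure (Ioc α t) := by
        rw [closure_Ioc h.ne]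
        exact left_mem_Icc.2 hαt
      exact hL.closure_subset_iff.2 hIoc this
  obtain ⟨ε, hε, hball⟩ := Metric.isOpen_iff.1 hO α (hLO hαL)
  obtain ⟨p, hpS, hp⟩ := exists_lt_of_lt_csSup hSne (show α - ε < α by linarith)
  have hpα : p ≤ α := le_csSup hSb hpS
  refine ⟨p, lt_of_le_of_ne hpS.1 fun h => hpS.2 (h ▸ ht), hpS.2, fun s hs => ?_⟩
  rcases le_or_gt s α with hsα | hsα
  · exact hball (by rw [Real.ball_eq_Ioo]; exact ⟨hp.trans_le hs.1, by linarith⟩)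
  · exact hLO (hIoc ⟨hsα, hs.2⟩)

theorem exists_gt_notMem {L O : Set ℝ} (hL : IsClosed L) (hO : IsOpen O) (hLO : L ⊆ O) {t : ℝ}
    (ht : t ∈ L) (hb : ∃ s ≥ t, s ∉ L) : ∃ q > t, q ∉ L ∧ Icc t q ⊆ O := by
  obtain ⟨s, hs, hsL⟩ := hb
  obtain ⟨p, hp, hpL, hpO⟩ := exists_lt_notMem (L := Neg.neg ⁻¹' L) (O := Neg.neg ⁻¹' O) (t := -t)
    (hL.preimage continuous_neg) (hO.preimage continuous_neg) (preimage_mono hLO)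
    (by simpa using ht) ⟨-s, by linarith, by simpa using hsL⟩
  refine ⟨-p, by linarith, hpL, fun s hs => ?_⟩
  have : -s ∈ Neg.neg ⁻¹' O := hpO ⟨by linarith [hs.2], by linarith [hs.1]⟩
  simpa using this

end Line

variable {c₁ c₂ : ℝ → ℝ}

theorem mem_slice_iff {x t : ℝ} : t ∈ slice c₁ c₂ x ↔ (x, t) ∈ strip c₁ c₂ := Iff.rfl

theorem eventually_notMem_slice {a u : ℝ} (hu : u ∉ slice c₁ c₂ a) :
    ∀ᶠ x in 𝓝 a, u ∉ slice c₁ c₂ x :=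
  (isClosed_Icc (a := c₁ u) (b := c₂ u)).isOpen_compl.mem_nhds hu

namespace IsAdmissible

theorem isClosed_strip (H : IsAdmissible c₁ c₂) : IsClosed (strip c₁ c₂) :=
  (isClosed_le (H.smooth₁.continuous.comp continuous_snd) continuous_fst).inter
    (isClosed_le continuous_fst (H.smooth₂.continuous.comp continuous_snd))

theorem isClosed_slice (H : IsAdmissible c₁ c₂) (x : ℝ) : IsClosed (slice c₁ c₂ x) :=
  (isClosed_le H.smooth₁.continuous continuous_const).inter
    (isClosed_le continuous_const H.smooth₂.continuous)

theorem eventually_escape (H : IsAdmissible c₁ c₂)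
    (M : ℝ) : ∀ᶠ t in cocompact ℝ, ∀ x, |x| ≤ M → t ∉ slice c₁ c₂ x := by
  filter_upwards [H.escape M] with t ht x hx htx
  rw [abs_le] at hx
  rcases ht with h | h
  · linarith [htx.1]
  · linarith [htx.2]

theorem exists_le_notMem_slice (H : IsAdmissible c₁ c₂) (x t : ℝ) : ∃ s ≤ t, s ∉ slice c₁ c₂ x := by
  obtain ⟨s, h1, h2⟩ := (((H.eventually_escape |x|).filter_mono atBot_le_cocompact).and
    (eventually_le_atBot t)).exists
  exact ⟨s, h2, h1 x le_rfl⟩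

theorem exists_ge_notMem_slice (H : IsAdmissible c₁ c₂) (x t : ℝ) : ∃ s ≥ t, s ∉ slice c₁ c₂ x := by
  obtain ⟨s, h1, h2⟩ := (((H.eventually_escape |x|).filter_mono atTop_le_cocompact).and
    (eventually_ge_atTop t)).exists
  exact ⟨s, h2, h1 x le_rfl⟩

theorem mem_slice_of_isCriticalAt (H : IsAdmissible c₁ c₂) {x t : ℝ} (h : IsCriticalAt c₁ c₂ x t) :
    t ∈ slice c₁ c₂ x := by
  rcases h with ⟨-, rfl⟩ | ⟨-, rfl⟩
  · exact ⟨le_rfl, (H.lt t).le⟩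
  · exact ⟨(H.lt t).le, le_rfl⟩

theorem isProperMap_fst (H : IsAdmissible c₁ c₂) : IsProperMap (fun z : strip c₁ c₂ => z.1.1) := by
  refine isProperMap_iff_isCompact_preimage.2
    ⟨continuous_fst.comp continuous_subtype_val, fun K hK => ?_⟩
  obtain ⟨M, hM⟩ := hK.isBounded.exists_norm_le
  obtain ⟨T, hT, hTM⟩ := mem_cocompact.1 (H.eventually_escape M)
  have hC := H.isClosed_strip.isClosedEmbedding_subtypeVal.isCompact_preimage (hK.prod hT)
  refine hC.of_isClosed_subset
    (hK.isClosed.preimage (continuous_fst.comp continuous_subtype_val)) fun z hz => ⟨hz, ?_⟩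
  by_contra hzT
  exact hTM hzT z.1.1 (hM _ hz) z.2

/-- A gap of a slice between two of its points comes from a critical point. -/
theorem exists_critical_of_gap (H : IsAdmissible c₁ c₂)
    {x s t u : ℝ} (hs : s ∈ slice c₁ c₂ x) (ht : t ∈ slice c₁ c₂ x)
    (hu : u ∈ Icc s t) (hux : u ∉ slice c₁ c₂ x) :
    ∃ w ∈ Icc s t, (w ∈ criticalSet c₁ ∧ x < c₁ w) ∨ (w ∈ criticalSet c₂ ∧ c₂ w < x) := by
  have hst : (Icc s t).Nonempty := ⟨u, hu⟩
  have hux' : x < c₁ u ∨ c₂ u < x := by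
    by_contra! hcon
    exact hux hcon
  -- The endpoints lie in the slice, so an extremum lying off the slice is interior and its
  -- derivative vanishes.
  have hint : ∀ w ∈ Icc s t, w ∉ slice c₁ c₂ x → Icc s t ∈ 𝓝 w := fun w hw hwx =>
    Icc_mem_nhds (lt_of_le_of_ne hw.1 fun h => hwx (h ▸ hs))
      (lt_of_le_of_ne hw.2 fun h => hwx (h ▸ ht))
  rcases hux' with h | h
  · obtain ⟨w, hw, hmax⟩ := isCompact_Icc.exists_isMaxOn hst H.smooth₁.continuous.continuousOn
    have hxw : x < c₁ w := h.trans_le (hmax hu)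
    exact ⟨w, hw, .inl ⟨(hmax.isLocalMax (hint w hw fun h => h.1.not_gt hxw)).deriv_eq_zero, hxw⟩⟩
  · obtain ⟨w, hw, hmin⟩ := isCompact_Icc.exists_isMinOn hst H.smooth₂.continuous.continuousOn
    have hxw : c₂ w < x := lt_of_le_of_lt (hmin hu) h
    exact ⟨w, hw, .inr ⟨(hmin.isLocalMin (hint w hw fun h => h.2.not_gt hxw)).deriv_eq_zero, hxw⟩⟩

/-- Every point of a slice has a neighbourhood with endpoints off the slice, in which gaps of
nearby slices come from critical points at the given level. -/
theorem exists_box (H : IsAdmissible c₁ c₂) {a t : ℝ} (ht : t ∈ slice c₁ c₂ a) :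
    ∃ δ > 0, ∃ p q, p < t ∧ t < q ∧ p ∉ slice c₁ c₂ a ∧ q ∉ slice c₁ c₂ a ∧
      (∀ x w, IsCriticalAt c₁ c₂ x w → x ∈ Ioo (a - δ) (a + δ) → x = a) ∧
      ∀ x ∈ Ioo (a - δ) (a + δ), ∀ s ∈ Icc p q, ∀ s' ∈ Icc p q,
        s ∈ slice c₁ c₂ x → s' ∈ slice c₁ c₂ x → ¬ uIcc s s' ⊆ slice c₁ c₂ x →
        x ≠ a ∧ ∃ w ∈ Icc p q, IsCriticalAt c₁ c₂ a w := by
  obtain ⟨δ, hδ, hiso⟩ := H.isolated a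
  -- Inside `O`, a critical value of `c₁` above a level within `δ` of `a`, or one of `c₂` below it,
  -- is itself within `δ` of `a`, hence equals `a`.
  set O := {s | c₁ s < a + δ ∧ a - δ < c₂ s}
  have hO : IsOpen O := (isOpen_lt H.smooth₁.continuous continuous_const).inter
    (isOpen_lt continuous_const H.smooth₂.continuous)
  have hLO : slice c₁ c₂ a ⊆ O := fun s hs => ⟨by linarith [hs.1], by linarith [hs.2]⟩
  obtain ⟨p, hpt, hpL, hpO⟩ := exists_lt_notMem (H.isClosed_slice a) hO hLO ht
    (H.exists_le_notMem_slice a t)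
  obtain ⟨q, hqt, hqL, hqO⟩ := exists_gt_notMem (H.isClosed_slice a) hO hLO ht
    (H.exists_ge_notMem_slice a t)
  have hpqO : Icc p q ⊆ O := by
    rw [← Icc_union_Icc_eq_Icc hpt.le hqt.le]
    exact union_subset hpO hqO
  have key : ∀ x ∈ Ioo (a - δ) (a + δ), ∀ s ∈ Icc p q, ∀ s' ∈ Icc p q,
      s ∈ slice c₁ c₂ x → s' ∈ slice c₁ c₂ x → ¬ Icc s s' ⊆ slice c₁ c₂ x →
      x ≠ a ∧ ∃ w ∈ Icc p q, IsCriticalAt c₁ c₂ a w := by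
    intro x hx s hs s' hs' hsx hsx' hgap
    obtain ⟨u, hu, hux⟩ := not_subset.1 hgap
    obtain ⟨w, hw, hcrit⟩ := H.exists_critical_of_gap hsx hsx' hu hux
    have hwpq : w ∈ Icc p q := ⟨hs.1.trans hw.1, hw.2.trans hs'.2⟩
    have hwO := hpqO hwpq
    rcases hcrit with ⟨hcr, hlt⟩ | ⟨hcr, hlt⟩
    · have := hiso _ (.inl ⟨w, hcr, rfl⟩) ⟨hx.1.trans hlt, hwO.1⟩
      exact ⟨by linarith, w, hwpq, .inl ⟨hcr, this⟩⟩
    · have := hiso _ (.inr ⟨w, hcr, rfl⟩) ⟨hwO.2, hlt.trans hx.2⟩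
      exact ⟨by linarith, w, hwpq, .inr ⟨hcr, this⟩⟩
  refine ⟨δ, hδ, p, q, hpt, hqt, hpL, hqL, ?_, ?_⟩
  · rintro x w (⟨hw, rfl⟩ | ⟨hw, rfl⟩) hx
    · exact hiso _ (.inl ⟨w, hw, rfl⟩) hx
    · exact hiso _ (.inr ⟨w, hw, rfl⟩) hx
  · intro x hx s hs s' hs' hsx hsx' hgap
    rcases le_total s s' with hle | hle
    · rw [uIcc_of_le hle] at hgap
      exact key x hx s hs s' hs' hsx hsx' hgap
    · rw [uIcc_of_ge hle] at hgap
      exact key x hx s' hs' s hs hsx' hsx hgap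

/-- Near a point of a slice that is not critical there are interior points of the slice. -/
theorem exists_interior_near (H : IsAdmissible c₁ c₂) {a t : ℝ} (ht : t ∈ slice c₁ c₂ a)
    (hcr : ¬ IsCriticalAt c₁ c₂ a t) {p q : ℝ} (hp : p < t) (hq : t < q) :
    ∃ s ∈ Ioo p q, c₁ s < a ∧ a < c₂ s := by
  have hc₁ := H.smooth₁.continuous
  have hc₂ := H.smooth₂.continuous
  by_cases h1 : c₁ t = a
  · have hmin : ¬ IsLocalMin c₁ t := fun hm => hcr (.inl ⟨hm.deriv_eq_zero, h1⟩)
    have h2 : ∀ᶠ s in 𝓝 t, a < c₂ s :=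
      hc₂.continuousAt.eventually (lt_mem_nhds (h1 ▸ H.lt t))
    obtain ⟨s, hs, hs2, hspq⟩ := ((not_eventually.1 hmin).and_eventually
      (h2.and (Ioo_mem_nhds hp hq))).exists
    exact ⟨s, hspq, by rw [← h1]; exact not_le.1 hs, hs2⟩
  by_cases h2 : c₂ t = a
  · have hmax : ¬ IsLocalMax c₂ t := fun hm => hcr (.inr ⟨hm.deriv_eq_zero, h2⟩)
    have h3 : ∀ᶠ s in 𝓝 t, c₁ s < a :=
      hc₁.continuousAt.eventually (gt_mem_nhds (h2 ▸ H.lt t))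
    obtain ⟨s, hs, hs2, hspq⟩ := ((not_eventually.1 hmax).and_eventually
      (h3.and (Ioo_mem_nhds hp hq))).exists
    exact ⟨s, hspq, hs2, by rw [← h2]; exact not_le.1 hs⟩
  exact ⟨t, ⟨hp, hq⟩, lt_of_le_of_ne ht.1 h1, lt_of_le_of_ne ht.2 (Ne.symm h2)⟩

/-- Interpolating linearly between the two graphs exhibits the strip as an image of `ℝ × [0, 1]`. -/
theorem connectedSpace_strip (H : IsAdmissible c₁ c₂) : ConnectedSpace (strip c₁ c₂) := by
  refine isConnected_iff_connectedSpace.1 ⟨⟨(c₁ 0, 0), le_rfl, (H.lt 0).le⟩, ?_⟩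
  have h1 := H.smooth₁.continuous
  have h2 := H.smooth₂.continuous
  have heq : strip c₁ c₂ = (fun w : ℝ × ℝ => (c₁ w.1 + w.2 * (c₂ w.1 - c₁ w.1), w.1)) ''
      (univ ×ˢ Icc 0 1) := by
    ext ⟨x, t⟩
    have hpos : 0 < c₂ t - c₁ t := sub_pos.2 (H.lt t)
    constructor
    · rintro ⟨hx1, hx2⟩
      refine ⟨(t, (x - c₁ t) / (c₂ t - c₁ t)), ⟨trivial, div_nonneg (sub_nonneg.2 hx1) hpos.le,
        (div_le_one hpos).2 (sub_le_sub_right hx2 _)⟩, ?_⟩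
      simp only [Prod.mk.injEq, and_true]
      field_simp
      ring
    · rintro ⟨⟨t', s⟩, ⟨-, hs0, hs1⟩, h⟩
      simp only [Prod.mk.injEq] at h
      obtain ⟨rfl, rfl⟩ := h
      simp only at hs0 hs1
      constructor <;> simp only <;> nlinarith
  rw [heq]
  exact (isPreconnected_univ.prod isPreconnected_Icc).image _ (by fun_prop)

end IsAdmissible

/-! ### The quotient of the strip by the components of its slices -/

/-- `Q` is the quotient map that collapses the components of the slices of the strip, `h` is the
induced height function, and `V` consists of the classes of the critical points. -/
structure IsContourMap (c₁ c₂ : ℝ → ℝ) {R : Type*} [TopologicalSpace R] (Q : strip c₁ c₂ → R)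
    (h : R → ℝ) (V : Set R) : Prop where
  isQuotientMap : IsQuotientMap Q
  eq_iff : ∀ z z', Q z = Q z' ↔ z.1.1 = z'.1.1 ∧ uIcc z.1.2 z'.1.2 ⊆ slice c₁ c₂ z.1.1
  height_apply : ∀ z, h (Q z) = z.1.1
  mem_vertex_iff : ∀ r, r ∈ V ↔ ∃ z, Q z = r ∧ IsCriticalAt c₁ c₂ z.1.1 z.1.2

namespace IsContourMap

variable {R : Type*} [TopologicalSpace R] {Q : strip c₁ c₂ → R} {h : R → ℝ} {V : Set R}

theorem continuous_height (K : IsContourMap c₁ c₂ Q h V) : Continuous h := by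
  rw [K.isQuotientMap.continuous_iff]
  exact (continuous_fst.comp continuous_subtype_val).congr fun z => (K.height_apply z).symm

theorem isProperMap_height (K : IsContourMap c₁ c₂ Q h V) (H : IsAdmissible c₁ c₂)
    : IsProperMap h := by
  refine isProperMap_of_comp_of_surj K.isQuotientMap.continuous K.continuous_height ?_
    K.isQuotientMap.surjective
  have : h ∘ Q = fun z => z.1.1 := funext K.height_apply
  rw [this]
  exact H.isProperMap_fst

theorem isOpen_image_of_saturated (K : IsContourMap c₁ c₂ Q h V)
    {S : Set (strip c₁ c₂)} (hS : IsOpen S)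
    (hsat : ∀ z ∈ S, ∀ z', Q z = Q z' → z' ∈ S) : IsOpen (Q '' S) := by
  rw [← K.isQuotientMap.isOpen_preimage]
  convert hS using 1
  refine Subset.antisymm ?_ (subset_preimage_image Q S)
  rintro z' ⟨z, hz, hzz⟩
  exact hsat z hz z' hzz

/-! ### Separation and local structure of the quotient -/

theorem lt_of_eq_of_notMem_slice (K : IsContourMap c₁ c₂ Q h V)
    {z z' : strip c₁ c₂} {u : ℝ} (hQ : Q z = Q z')
    (hu : u ∉ slice c₁ c₂ z.1.1) (hz : z.1.2 < u) : z'.1.2 < u := by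
  by_contra! hle
  have := ((K.eq_iff z z').1 hQ).2
  rw [uIcc_of_le (hz.le.trans hle)] at this
  exact hu (this ⟨hz.le, hle⟩)

theorem gt_of_eq_of_notMem_slice (K : IsContourMap c₁ c₂ Q h V)
    {z z' : strip c₁ c₂} {u : ℝ} (hQ : Q z = Q z')
    (hu : u ∉ slice c₁ c₂ z.1.1) (hz : u < z.1.2) : u < z'.1.2 := by
  by_contra! hle
  have := ((K.eq_iff z z').1 hQ).2
  rw [uIcc_of_ge (hle.trans hz.le)] at this
  exact hu (this ⟨hle, hz.le⟩)

theorem fst_eq (K : IsContourMap c₁ c₂ Q h V)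
    {z z' : strip c₁ c₂} (hQ : Q z = Q z') : z.1.1 = z'.1.1 :=
  ((K.eq_iff z z').1 hQ).1

/-- The parameter `u` stays off the slices of all nearby levels, and no class jumps across it, so
the two sides of `u` are saturated open sets. -/
theorem separation_of_notMem_slice (K : IsContourMap c₁ c₂ Q h V)
    {z z' : strip c₁ c₂} (hzz : z.1.1 = z'.1.1) {u : ℝ}
    (hu : u ∉ slice c₁ c₂ z.1.1) (hz : z.1.2 < u) (hz' : u < z'.1.2) :
    ∃ A B : Set R, IsOpen A ∧ IsOpen B ∧ Q z ∈ A ∧ Q z' ∈ B ∧ Disjoint A B := by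
  set J := {x | u ∉ slice c₁ c₂ x}
  have hJ : IsOpen J := (isClosed_Icc (a := c₁ u) (b := c₂ u)).isOpen_compl
  have hf : Continuous fun z : strip c₁ c₂ => z.1.1 := by fun_prop
  have hs : Continuous fun z : strip c₁ c₂ => z.1.2 := by fun_prop
  refine ⟨Q '' {y | y.1.1 ∈ J ∧ y.1.2 < u}, Q '' {y | y.1.1 ∈ J ∧ u < y.1.2},
    K.isOpen_image_of_saturated ((hJ.preimage hf).inter (isOpen_lt hs continuous_const)) ?_,
    K.isOpen_image_of_saturated ((hJ.preimage hf).inter (isOpen_lt continuous_const hs)) ?_,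
    ⟨z, ⟨hu, hz⟩, rfl⟩, ⟨z', ⟨by rwa [← hzz], hz'⟩, rfl⟩, ?_⟩
  · intro y hy y' hyy
    exact ⟨by rw [← K.fst_eq hyy]; exact hy.1, K.lt_of_eq_of_notMem_slice hyy hy.1 hy.2⟩
  · intro y hy y' hyy
    exact ⟨by rw [← K.fst_eq hyy]; exact hy.1, K.gt_of_eq_of_notMem_slice hyy hy.1 hy.2⟩
  · rw [disjoint_left]
    rintro _ ⟨y, hy, rfl⟩ ⟨y', hy', hyy⟩
    exact lt_asymm hy'.2 (K.lt_of_eq_of_notMem_slice hyy.symm hy.1 hy.2)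

theorem t2Space (K : IsContourMap c₁ c₂ Q h V) : T2Space R := by
  refine ⟨fun r r' hrr => ?_⟩
  obtain ⟨z, rfl⟩ := K.isQuotientMap.surjective r
  obtain ⟨z', rfl⟩ := K.isQuotientMap.surjective r'
  by_cases hx : z.1.1 = z'.1.1
  · obtain ⟨u, hu, huL⟩ := not_subset.1 fun hsub => hrr ((K.eq_iff z z').2 ⟨hx, hsub⟩)
    have h1 : z.1.2 ≠ u := fun h => huL (h ▸ z.2)
    have h2 : z'.1.2 ≠ u := fun h => huL (by rw [hx, ← h]; exact z'.2)
    rcases mem_uIcc.1 hu with hu | hu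
    · exact K.separation_of_notMem_slice hx huL (lt_of_le_of_ne hu.1 h1)
        (lt_of_le_of_ne hu.2 h2.symm)
    · obtain ⟨A, B, hA, hB, hzA, hzB, hd⟩ := K.separation_of_notMem_slice hx.symm (hx ▸ huL)
        (lt_of_le_of_ne hu.1 h2) (lt_of_le_of_ne hu.2 h1.symm)
      exact ⟨B, A, hB, hA, hzB, hzA, hd.symm⟩
  · exact separated_by_continuous K.continuous_height (by rwa [K.height_apply, K.height_apply])

theorem connectedSpace (K : IsContourMap c₁ c₂ Q h V) (H : IsAdmissible c₁ c₂) : ConnectedSpace R :=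
  have := H.connectedSpace_strip
  K.isQuotientMap.surjective.connectedSpace K.isQuotientMap.continuous

/-- The classes over a box whose vertical sides miss the strip form an open set. -/
theorem isOpen_image_box (K : IsContourMap c₁ c₂ Q h V) {J : Set ℝ} (hJ : IsOpen J) {p q : ℝ}
    (hp : ∀ x ∈ J, p ∉ slice c₁ c₂ x) (hq : ∀ x ∈ J, q ∉ slice c₁ c₂ x) :
    IsOpen (Q '' {z | z.1.1 ∈ J ∧ z.1.2 ∈ Ioo p q}) := by
  have hf : Continuous fun z : strip c₁ c₂ => z.1.1 := by fun_prop
  have hs : Continuous fun z : strip c₁ c₂ => z.1.2 := by fun_prop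
  refine K.isOpen_image_of_saturated ((hJ.preimage hf).inter (isOpen_Ioo.preimage hs)) ?_
  intro y hy y' hyy
  exact ⟨show y'.1.1 ∈ J by rw [← K.fst_eq hyy]; exact hy.1,
    K.gt_of_eq_of_notMem_slice hyy (hp _ hy.1) hy.2.1,
    K.lt_of_eq_of_notMem_slice hyy (hq _ hy.1) hy.2.2⟩

/-- The fibre is compact by properness and discrete, since the box of `exists_box` has no gap at the
level `a` itself and thus contains only one class there. -/
theorem finite_fiber (K : IsContourMap c₁ c₂ Q h V) (H : IsAdmissible c₁ c₂)
    (a : ℝ) : (h ⁻¹' {a}).Finite := by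
  have hcomp : IsCompact (h ⁻¹' {a}) :=
    (isProperMap_iff_isCompact_preimage.1 (K.isProperMap_height H)).2 isCompact_singleton
  have hloc : ∀ r, ∃ U, r ∈ h ⁻¹' {a} → U ∈ 𝓝 r ∧ U ∩ h ⁻¹' {a} ⊆ {r} := by
    intro r
    by_cases hr : r ∈ h ⁻¹' {a}
    swap
    · exact ⟨∅, fun h => absurd h hr⟩
    obtain ⟨⟨⟨x, t⟩, hz⟩, rfl⟩ := K.isQuotientMap.surjective r
    obtain rfl : x = a := by
      have := K.height_apply ⟨(x, t), hz⟩
      rwa [mem_singleton_iff.1 hr, eq_comm] at this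
    obtain ⟨δ, hδ, p, q, hpt, htq, hp, hq, -, hbox⟩ := H.exists_box (mem_slice_iff.2 hz)
    set J := {y | p ∉ slice c₁ c₂ y} ∩ {y | q ∉ slice c₁ c₂ y}
    have hJ : IsOpen J := (isClosed_Icc (a := c₁ p) (b := c₂ p)).isOpen_compl.inter
      (isClosed_Icc (a := c₁ q) (b := c₂ q)).isOpen_compl
    refine ⟨_, fun _ => ⟨(K.isOpen_image_box hJ (fun y hy => hy.1) (fun y hy => hy.2)).mem_nhds
      ⟨⟨(x, t), hz⟩, ⟨⟨hp, hq⟩, hpt, htq⟩, rfl⟩, ?_⟩⟩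
    rintro _ ⟨⟨⟨⟨x', t'⟩, hz'⟩, hm, rfl⟩, hx'⟩
    obtain rfl : x' = x := by
      have := K.height_apply ⟨(x', t'), hz'⟩
      rwa [mem_singleton_iff.1 hx', eq_comm] at this
    refine (K.eq_iff _ _).2 ⟨rfl, ?_⟩
    by_contra hgap
    exact (hbox x' ⟨by linarith, by linarith⟩ t' (Ioo_subset_Icc_self hm.2) t ⟨hpt.le, htq.le⟩
      hz' hz hgap).1 rfl
  choose U hU using hloc
  obtain ⟨F, hFa, hF⟩ := hcomp.elim_nhds_subcover U fun r hr => (hU r hr).1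
  refine (F.finite_toSet.subset fun r hr => ?_)
  obtain ⟨s, hs, hrs⟩ := mem_iUnion₂.1 (hF hr)
  rw [mem_singleton_iff.1 ((hU s (hFa s hs)).2 ⟨hrs, hr⟩)]
  exact hs

theorem isolated (K : IsContourMap c₁ c₂ Q h V) (H : IsAdmissible c₁ c₂) (a : ℝ) :
    ∃ δ > 0, ∀ v ∈ V, h v ∈ Ioo (a - δ) (a + δ) → h v = a := by
  obtain ⟨δ, hδ, hiso⟩ := H.isolated a
  refine ⟨δ, hδ, fun v hv hva => ?_⟩
  obtain ⟨z, rfl, hz⟩ := (K.mem_vertex_iff v).1 hv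
  rw [K.height_apply] at hva ⊢
  rcases hz with ⟨hz, hzx⟩ | ⟨hz, hzx⟩
  · exact hiso _ (.inl ⟨_, hz, hzx⟩) hva
  · exact hiso _ (.inr ⟨_, hz, hzx⟩) hva

/-- A critical point of level `a` in the box of `exists_box` would belong to the class `r`. So there
is none, nearby slices have no gaps in the box, and holding the parameter at an interior point `t₀`
gives a section `κ` of the height onto a neighbourhood of `r`. -/
theorem chart (K : IsContourMap c₁ c₂ Q h V) (H : IsAdmissible c₁ c₂) {r : R} (hr : r ∉ V) :
    ∃ U, IsOpen U ∧ r ∈ U ∧ IsPreconnected U ∧ U ⊆ Vᶜ ∧ InjOn h U ∧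
      ∀ W ⊆ U, IsOpen W → IsOpen (h '' W) := by
  obtain ⟨⟨⟨a, t⟩, hz⟩, rfl⟩ := K.isQuotientMap.surjective r
  obtain ⟨δ, hδ, p, q, hpt, htq, hp, hq, hval, hbox⟩ := H.exists_box (mem_slice_iff.2 hz)
  have hconn : ∀ (w : ℝ) (hw : (a, w) ∈ strip c₁ c₂), w ∈ Icc p q →
      Q ⟨(a, w), hw⟩ = Q ⟨(a, t), hz⟩ := by
    intro w hw hwpq
    refine (K.eq_iff _ _).2 ⟨rfl, ?_⟩
    by_contra hgap
    exact (hbox a ⟨by linarith, by linarith⟩ w hwpq t ⟨hpt.le, htq.le⟩ hw hz hgap).1 rfl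
  have hnc : ∀ w ∈ Icc p q, ¬ IsCriticalAt c₁ c₂ a w := fun w hw hcr =>
    hr ((K.mem_vertex_iff _).2 ⟨⟨(a, w), H.mem_slice_of_isCriticalAt hcr⟩, hconn w _ hw, hcr⟩)
  obtain ⟨t₀, ht₀, ht₁, ht₂⟩ := H.exists_interior_near (mem_slice_iff.2 hz)
    (hnc t ⟨hpt.le, htq.le⟩) hpt htq
  have hev : ∀ᶠ x in 𝓝 a, p ∉ slice c₁ c₂ x ∧ q ∉ slice c₁ c₂ x ∧ x ∈ Ioo (c₁ t₀) (c₂ t₀) ∧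
      x ∈ Ioo (a - δ) (a + δ) :=
    (eventually_notMem_slice hp).and ((eventually_notMem_slice hq).and
      ((eventually_mem_set.2 (Ioo_mem_nhds ht₁ ht₂)).and
        (Ioo_mem_nhds (by linarith) (by linarith))))
  obtain ⟨ε, hε, hball⟩ := Metric.eventually_nhds_iff_ball.1 hev
  rw [Real.ball_eq_Ioo] at hball
  set J := Ioo (a - ε) (a + ε)
  have hstrip : ∀ x ∈ J, (x, t₀) ∈ strip c₁ c₂ := fun x hx =>
    ⟨(hball x hx).2.2.1.1.le, (hball x hx).2.2.1.2.le⟩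
  set κ : J → R := fun x => Q ⟨(x, t₀), hstrip x x.2⟩
  have hκ : Continuous κ := K.isQuotientMap.continuous.comp (by fun_prop)
  have hhκ : ∀ x, h (κ x) = x := fun x => K.height_apply _
  set U := Q '' {z | z.1.1 ∈ J ∧ z.1.2 ∈ Ioo p q}
  have hUκ : ∀ (z : strip c₁ c₂) (hzJ : z.1.1 ∈ J), z.1.2 ∈ Ioo p q → Q z = κ ⟨z.1.1, hzJ⟩ := by
    intro z hzJ hzpq
    refine (K.eq_iff _ _).2 ⟨rfl, ?_⟩
    by_contra hgap
    obtain ⟨-, w, hw, hcr⟩ := hbox z.1.1 (hball _ hzJ).2.2.2 z.1.2 (Ioo_subset_Icc_self hzpq) t₀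
      (Ioo_subset_Icc_self ht₀) z.2 (hstrip _ hzJ) hgap
    exact hnc w hw hcr
  have hUr : U = range κ := by
    refine Subset.antisymm ?_ ?_
    · rintro _ ⟨z, ⟨hzJ, hzpq⟩, rfl⟩
      exact ⟨_, (hUκ z hzJ hzpq).symm⟩
    · rintro _ ⟨x, rfl⟩
      exact ⟨_, ⟨x.2, ht₀⟩, rfl⟩
  have haJ : a ∈ J := ⟨by linarith, by linarith⟩
  refine ⟨U, K.isOpen_image_box isOpen_Ioo (fun x hx => (hball x hx).1)
    (fun x hx => (hball x hx).2.1), ⟨_, ⟨haJ, hpt, htq⟩, rfl⟩, ?_, ?_, ?_, ?_⟩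
  · have : PreconnectedSpace J := Subtype.preconnectedSpace isPreconnected_Ioo
    rw [hUr]
    exact isPreconnected_range hκ
  · rintro _ ⟨z, ⟨hzJ, hzpq⟩, rfl⟩ hzV
    obtain ⟨z', hzz, hcr⟩ := (K.mem_vertex_iff _).1 hzV
    rw [K.fst_eq hzz] at hcr
    have hza : z.1.1 = a := hval _ _ hcr (hball _ hzJ).2.2.2
    obtain ⟨⟨x, s⟩, hz₁⟩ := z
    obtain rfl : x = a := hza
    exact hr (hconn s hz₁ (Ioo_subset_Icc_self hzpq) ▸ hzV)
  · rw [hUr]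
    rintro _ ⟨x, rfl⟩ _ ⟨y, rfl⟩ hxy
    rw [hhκ, hhκ] at hxy
    rw [Subtype.ext hxy]
  · intro W hWU hW
    have : h '' W = Subtype.val '' (κ ⁻¹' W) := by
      ext b
      constructor
      · rintro ⟨w, hw, rfl⟩
        obtain ⟨x, rfl⟩ := hUr ▸ hWU hw
        exact ⟨x, hw, (hhκ x).symm⟩
      · rintro ⟨x, hx, rfl⟩
        exact ⟨κ x, hx, hhκ x⟩
    rw [this]
    exact isOpen_Ioo.isOpenMap_subtype_val _ (hW.preimage hκ)

theorem isHeight (K : IsContourMap c₁ c₂ Q h V) (H : IsAdmissible c₁ c₂) : IsHeight V h where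
  proper := K.isProperMap_height H
  finite_fiber := K.finite_fiber H
  isolated := K.isolated H
  chart _ hr := K.chart H hr

theorem exists_height_ne (K : IsContourMap c₁ c₂ Q h V) (H : IsAdmissible c₁ c₂)
    : ∃ r s, h r ≠ h s := by
  refine ⟨Q ⟨(c₁ 0, 0), le_rfl, (H.lt 0).le⟩, Q ⟨(c₂ 0, 0), (H.lt 0).le, le_rfl⟩, ?_⟩
  rw [K.height_apply, K.height_apply]
  exact (H.lt 0).ne

theorem nonempty_vertex (K : IsContourMap c₁ c₂ Q h V) (H : IsAdmissible c₁ c₂)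
    (hcrit : (criticalSet c₁ ∪ criticalSet c₂).Nonempty) : V.Nonempty := by
  obtain ⟨w, hw | hw⟩ := hcrit
  · exact ⟨_, (K.mem_vertex_iff _).2 ⟨⟨(c₁ w, w), le_rfl, (H.lt w).le⟩, rfl, .inl ⟨hw, rfl⟩⟩⟩
  · exact ⟨_, (K.mem_vertex_iff _).2 ⟨⟨(c₂ w, w), (H.lt w).le, le_rfl⟩, rfl, .inr ⟨hw, rfl⟩⟩⟩

theorem isGraphWithEnds (K : IsContourMap c₁ c₂ Q h V) (H : IsAdmissible c₁ c₂)
    (hcrit : (criticalSet c₁ ∪ criticalSet c₂).Nonempty) : IsGraphWithEnds R V :=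
  have := K.t2Space
  have := K.connectedSpace H
  (K.isHeight H).isGraphWithEnds (K.nonempty_vertex H hcrit) (K.exists_height_ne H)

/-! ### Edges of unbounded height -/

/-- A half-line of parameters that is separated from all critical points yields an edge of
unbounded height. -/
theorem exists_unbounded_edge (K : IsContourMap c₁ c₂ Q h V) (H : IsAdmissible c₁ c₂)
    {l : Filter ℝ} [l.NeBot]
    (hl : l ≤ cocompact ℝ) {P : Set ℝ} (hP : IsPreconnected P) (hPl : P ∈ l) {T : ℝ}
    (hT : ∀ w ∈ criticalSet c₁ ∪ criticalSet c₂, ∀ t ∈ P, T ∈ uIcc w t)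
    (hcT : ∀ t ∈ P, T ∉ slice c₁ c₂ (c₁ t)) :
    ∃ e ∈ edges V, ¬ (BddBelow (h '' e) ∧ BddAbove (h '' e)) := by
  have hc₁ := H.smooth₁.continuous
  -- The path along the lower boundary. A critical point in the class of `κ t` with `t ∈ P` would
  -- have `T` between it and `t`, although `T` is off that slice.
  set κ : ℝ → R := fun t => Q ⟨(c₁ t, t), le_rfl, (H.lt t).le⟩
  have hκ : Continuous κ := K.isQuotientMap.continuous.comp (by fun_prop)
  have hκV : κ '' P ⊆ Vᶜ := by
    rintro _ ⟨t, ht, rfl⟩ htV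
    obtain ⟨z, hzt, hz⟩ := (K.mem_vertex_iff _).1 htV
    have hw : z.1.2 ∈ criticalSet c₁ ∪ criticalSet c₂ := hz.imp And.left And.left
    obtain ⟨hx, hsub⟩ := (K.eq_iff _ _).1 hzt
    have hmem := hsub (hT _ hw t ht)
    rw [hx] at hmem
    exact hcT t ht hmem
  obtain ⟨t₀, ht₀⟩ := Filter.nonempty_of_mem hPl
  have ht₀V : κ t₀ ∈ Vᶜ := hκV ⟨t₀, ht₀, rfl⟩
  refine ⟨_, ⟨κ t₀, ht₀V, rfl⟩, ?_⟩
  have hsub : κ '' P ⊆ connectedComponentIn Vᶜ (κ t₀) :=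
    (hP.image κ hκ.continuousOn).subset_connectedComponentIn ⟨t₀, ht₀, rfl⟩ hκV
  rintro ⟨⟨m, hm⟩, ⟨M, hM⟩⟩
  obtain ⟨t, ht, htP⟩ := (((H.escape (max M (-m))).filter_mono hl).and hPl).exists
  have hmem : c₁ t ∈ h '' connectedComponentIn Vᶜ (κ t₀) :=
    ⟨κ t, hsub ⟨t, htP, rfl⟩, K.height_apply _⟩
  rcases ht with ht | ht
  · linarith [hM hmem, le_max_left M (-m)]
  · linarith [hm hmem, le_max_right M (-m), H.lt t]

theorem exists_unbounded_edge_of_bddAbove (K : IsContourMap c₁ c₂ Q h V) (H : IsAdmissible c₁ c₂)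
    (hb : BddAbove (criticalSet c₁ ∪ criticalSet c₂)) :
    ∃ e ∈ edges V, ¬ (BddBelow (h '' e) ∧ BddAbove (h '' e)) := by
  obtain ⟨T, hT⟩ := hb
  -- Beyond `T'` the level `c₁ t` avoids `[c₁ T, c₂ T]`, so the slice at that level misses `T`.
  obtain ⟨T', hT'⟩ := eventually_atTop.1 (((H.escape (max |c₁ T| |c₂ T|)).filter_mono
    atTop_le_cocompact).and (eventually_ge_atTop T))
  refine K.exists_unbounded_edge H atTop_le_cocompact isPreconnected_Ici (Ici_mem_atTop T')
    (T := T) (fun w hw t ht => mem_uIcc.2 (.inl ⟨hT hw, (hT' t ht).2⟩)) fun t ht hts => ?_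
  have h1 := neg_abs_le (c₁ T)
  have h2 := le_abs_self (c₂ T)
  rcases (hT' t ht).1 with h | h
  · linarith [hts.2, le_max_right |c₁ T| |c₂ T|]
  · linarith [hts.1, le_max_left |c₁ T| |c₂ T|, H.lt t]

theorem exists_unbounded_edge_of_bddBelow (K : IsContourMap c₁ c₂ Q h V) (H : IsAdmissible c₁ c₂)
    (hb : BddBelow (criticalSet c₁ ∪ criticalSet c₂)) :
    ∃ e ∈ edges V, ¬ (BddBelow (h '' e) ∧ BddAbove (h '' e)) := by
  obtain ⟨T, hT⟩ := hb
  obtain ⟨T', hT'⟩ := eventually_atBot.1 (((H.escape (max |c₁ T| |c₂ T|)).filter_mono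
    atBot_le_cocompact).and (eventually_le_atBot T))
  refine K.exists_unbounded_edge H atBot_le_cocompact isPreconnected_Iic (Iic_mem_atBot T')
    (T := T) (fun w hw t ht => mem_uIcc.2 (.inr ⟨(hT' t ht).2, hT hw⟩)) fun t ht hts => ?_
  have h1 := neg_abs_le (c₁ T)
  have h2 := le_abs_self (c₂ T)
  rcases (hT' t ht).1 with h | h
  · linarith [hts.2, le_max_right |c₁ T| |c₂ T|]
  · linarith [hts.1, le_max_left |c₁ T| |c₂ T|, H.lt t]

/-- The classes of the points of the strip on a vertical line separate the quotient, so a connected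
set that contains points on both sides meets them. -/
theorem exists_mem_fiber (K : IsContourMap c₁ c₂ Q h V) {T : Set R} (hT : IsPreconnected T) {w : ℝ}
    {z z' : strip c₁ c₂} (hz : Q z ∈ T) (hz' : Q z' ∈ T) (hzw : z.1.2 < w) (hzw' : w < z'.1.2)
    (hw : w ∉ slice c₁ c₂ z.1.1) (hw' : w ∉ slice c₁ c₂ z'.1.1) :
    ∃ (x : ℝ) (hx : (x, w) ∈ strip c₁ c₂), Q ⟨(x, w), hx⟩ ∈ T := by
  have := K.t2Space
  set κ : Icc (c₁ w) (c₂ w) → R := fun x => Q ⟨(x, w), x.2⟩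
  have hκ : Continuous κ := K.isQuotientMap.continuous.comp (by fun_prop)
  have hF : IsClosed (range κ) := (isCompact_range hκ).isClosed
  -- A class with parameters on both sides of `w` contains a point over `w`; off `range κ` the two
  -- sides are therefore saturated.
  have hmemF : ∀ y : strip c₁ c₂, ∀ y', Q y = Q y' → w ∈ uIcc y.1.2 y'.1.2 → Q y ∈ range κ := by
    intro y y' hyy hw
    obtain ⟨hx, hsub⟩ := (K.eq_iff y y').1 hyy
    refine ⟨⟨y.1.1, hsub hw⟩, (K.eq_iff _ _).2 ⟨rfl, Subset.trans ?_ hsub⟩⟩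
    exact uIcc_subset_uIcc hw left_mem_uIcc
  have hnF : ∀ y : strip c₁ c₂, w ∉ slice c₁ c₂ y.1.1 → Q y ∉ range κ := by
    rintro y hy ⟨x, hx⟩
    have : x.1 = y.1.1 := K.fst_eq hx
    exact hy (this ▸ x.2)
  have hs : Continuous fun z : strip c₁ c₂ => z.1.2 := by fun_prop
  have hFo : IsOpen (Q ⁻¹' (range κ)ᶜ) := hF.isOpen_compl.preimage K.isQuotientMap.continuous
  set A : Set (strip c₁ c₂) := {y | y.1.2 < w} ∩ Q ⁻¹' (range κ)ᶜ
  set B : Set (strip c₁ c₂) := {y | w < y.1.2} ∩ Q ⁻¹' (range κ)ᶜ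
  have hAsat : ∀ y ∈ A, ∀ y', Q y = Q y' → y' ∈ A := by
    rintro y ⟨hy, hyF⟩ y' hyy
    refine ⟨?_, by rw [mem_preimage, ← hyy]; exact hyF⟩
    by_contra hle
    exact hyF (hmemF y y' hyy (mem_uIcc.2 (.inl ⟨le_of_lt hy, not_lt.1 hle⟩)))
  have hBsat : ∀ y ∈ B, ∀ y', Q y = Q y' → y' ∈ B := by
    rintro y ⟨hy, hyF⟩ y' hyy
    refine ⟨?_, by rw [mem_preimage, ← hyy]; exact hyF⟩
    by_contra hle
    exact hyF (hmemF y y' hyy (mem_uIcc.2 (.inr ⟨not_lt.1 hle, le_of_lt hy⟩)))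
  have hA : IsOpen (Q '' A) :=
    K.isOpen_image_of_saturated ((isOpen_lt hs continuous_const).inter hFo) hAsat
  have hB : IsOpen (Q '' B) :=
    K.isOpen_image_of_saturated ((isOpen_lt continuous_const hs).inter hFo) hBsat
  have hd : Disjoint (Q '' A) (Q '' B) := by
    rw [disjoint_left]
    rintro _ ⟨y, hy, rfl⟩ ⟨y', hy', hyy⟩
    exact lt_asymm (show w < y'.1.2 from hy'.1) (hAsat y hy y' hyy.symm).1
  by_contra hcon
  push Not at hcon
  have hTsub : T ⊆ Q '' A ∪ Q '' B := by
    intro r hr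
    obtain ⟨y, rfl⟩ := K.isQuotientMap.surjective r
    have hyF : Q y ∉ range κ := by
      rintro ⟨x, hx⟩
      exact hcon x x.2 (show κ x ∈ T from hx ▸ hr)
    have hne : y.1.2 ≠ w := fun h => hyF (hmemF y y rfl (by simp [h]))
    rcases lt_or_gt_of_ne hne with h | h
    · exact .inl ⟨y, ⟨h, hyF⟩, rfl⟩
    · exact .inr ⟨y, ⟨h, hyF⟩, rfl⟩
  have hTA := hT.subset_left_of_subset_union hA hB hd hTsub
    ⟨Q z, hz, z, ⟨hzw, hnF z hw⟩, rfl⟩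
  exact disjoint_left.1 hd (hTA hz') ⟨z', ⟨hzw', hnF z' hw'⟩, rfl⟩

/-- An edge cannot pass over a critical point on an unbounded range of levels. -/
theorem not_crossing (K : IsContourMap c₁ c₂ Q h V) (H : IsAdmissible c₁ c₂)
    {e : Set R} (he : e ∈ edges V) {q : Set ℝ}
    (hq : q.OrdConnected) (hqe : q ⊆ h '' e) {x₀ w : ℝ}
    (hx₀ : ∀ Z : Set ℝ, Z.OrdConnected → x₀ ∉ Z → (Z ∩ q).Nonempty → Z ⊆ q)
    (hw : w ∈ criticalSet c₁ ∪ criticalSet c₂) (hwx₀ : w ∉ slice c₁ c₂ x₀) {z z' : strip c₁ c₂}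
    (hz : Q z ∈ e ∩ h ⁻¹' q) (hz' : Q z' ∈ e ∩ h ⁻¹' q) (hzw : z.1.2 < w) (hzw' : w < z'.1.2)
    (hwz : w ∉ slice c₁ c₂ z.1.1) (hwz' : w ∉ slice c₁ c₂ z'.1.1) : False := by
  have := K.t2Space
  have HH := K.isHeight H
  obtain ⟨x, hx, hxe, hxq⟩ := K.exists_mem_fiber (HH.isPreconnected_edge_inter he hq) hz hz' hzw
    hzw' hwz hwz'
  rw [mem_preimage, K.height_apply] at hxq
  -- The levels over `w` form an interval that meets `q` and omits `x₀`, the endpoint of the ray `q`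
  -- in the application.
  have hsub : Icc (c₁ w) (c₂ w) ⊆ q := hx₀ _ ordConnected_Icc hwx₀ ⟨x, hx, hxq⟩
  set κ : Icc (c₁ w) (c₂ w) → R := fun x => Q ⟨(x, w), x.2⟩
  have hκ : Continuous κ := K.isQuotientMap.continuous.comp (by fun_prop)
  have : PreconnectedSpace (Icc (c₁ w) (c₂ w)) := Subtype.preconnectedSpace isPreconnected_Icc
  -- The edge is relatively closed over its image, so it swallows the whole connected segment over
  -- `w`, one end of which is a vertex.
  have hFe : range κ ⊆ e := by
    refine (isPreconnected_range hκ).subset_of_closure_inter_subset (HH.isOpen_edge he)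
      ⟨_, ⟨⟨x, hx⟩, rfl⟩, hxe⟩ ?_
    rintro _ ⟨hcl, y, rfl⟩
    refine HH.closure_inter_preimage_subset he ⟨hcl, ?_⟩
    rw [mem_preimage, K.height_apply]
    exact hqe (hsub y.2)
  rcases hw with hw | hw
  · exact IsHeight.subset_compl he (hFe ⟨⟨c₁ w, le_rfl, (H.lt w).le⟩, rfl⟩)
      ((K.mem_vertex_iff _).2 ⟨_, rfl, .inl ⟨hw, rfl⟩⟩)
  · exact IsHeight.subset_compl he (hFe ⟨⟨c₂ w, (H.lt w).le, le_rfl⟩, rfl⟩)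
      ((K.mem_vertex_iff _).2 ⟨_, rfl, .inr ⟨hw, rfl⟩⟩)

/-- Around a point of the edge at level `x₀`, choose critical parameters `w₁ < w₂` on either side
and off the slice at `x₀`. At a level exceeding in absolute value all values of both functions on
`[w₁, w₂]`, the edge has left that interval, so it crossed `w₁` or `w₂`, against `not_crossing`. -/
theorem false_of_unbounded (K : IsContourMap c₁ c₂ Q h V) (H : IsAdmissible c₁ c₂)
    (hb : ¬ BddBelow (criticalSet c₁ ∪ criticalSet c₂))
    (ha : ¬ BddAbove (criticalSet c₁ ∪ criticalSet c₂)) {e : Set R} (he : e ∈ edges V) {q : Set ℝ}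
    (hq : q.OrdConnected) (hqe : q ⊆ h '' e) {x₀ : ℝ} (hx₀q : x₀ ∈ q)
    (hx₀ : ∀ Z : Set ℝ, Z.OrdConnected → x₀ ∉ Z → (Z ∩ q).Nonempty → Z ⊆ q)
    (hun : ∀ M, ∃ x ∈ q, M < |x|) : False := by
  have hlift : ∀ x ∈ q, ∃ z, Q z ∈ e ∩ h ⁻¹' q ∧ z.1.1 = x := by
    intro x hx
    obtain ⟨r, hr, hrx⟩ := hqe hx
    obtain ⟨z, rfl⟩ := K.isQuotientMap.surjective r
    have hzx : z.1.1 = x := by rw [← hrx, K.height_apply]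
    exact ⟨z, ⟨hr, by rw [mem_preimage, hrx]; exact hx⟩, hzx⟩
  obtain ⟨z₀, hz₀, hzx₀⟩ := hlift x₀ hx₀q
  obtain ⟨w₂, hw₂, hw₂S, hw₂t⟩ : ∃ w, w ∉ slice c₁ c₂ x₀ ∧
      w ∈ criticalSet c₁ ∪ criticalSet c₂ ∧ z₀.1.2 < w := by
    obtain ⟨N, hN⟩ := eventually_atTop.1 (atTop_le_cocompact (H.eventually_escape |x₀|))
    obtain ⟨w, hw, hwN⟩ := not_bddAbove_iff.1 ha (max N z₀.1.2)
    exact ⟨w, hN w ((le_max_left _ _).trans hwN.le) x₀ le_rfl, hw,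
      (le_max_right _ _).trans_lt hwN⟩
  obtain ⟨w₁, hw₁, hw₁S, hw₁t⟩ : ∃ w, w ∉ slice c₁ c₂ x₀ ∧
      w ∈ criticalSet c₁ ∪ criticalSet c₂ ∧ w < z₀.1.2 := by
    obtain ⟨N, hN⟩ := eventually_atBot.1 (atBot_le_cocompact (H.eventually_escape |x₀|))
    obtain ⟨w, hw, hwN⟩ := not_bddBelow_iff.1 hb (min N z₀.1.2)
    exact ⟨w, hN w (hwN.le.trans (min_le_left _ _)) x₀ le_rfl, hw,
      hwN.trans_le (min_le_right _ _)⟩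
  obtain ⟨M₁, hM₁⟩ := (isCompact_Icc (a := w₁) (b := w₂)).exists_bound_of_continuousOn
    H.smooth₁.continuous.continuousOn
  obtain ⟨M₂, hM₂⟩ := (isCompact_Icc (a := w₁) (b := w₂)).exists_bound_of_continuousOn
    H.smooth₂.continuous.continuousOn
  obtain ⟨x₁, hx₁q, hx₁⟩ := hun (max M₁ M₂)
  have hout : ∀ t ∈ Icc w₁ w₂, t ∉ slice c₁ c₂ x₁ := by
    intro t ht hts
    have h1 := (abs_le.1 ((hM₁ t ht).trans (le_max_left M₁ M₂))).1
    have h2 := (abs_le.1 ((hM₂ t ht).trans (le_max_right M₁ M₂))).2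
    exact hx₁.not_ge (abs_le.2 ⟨h1.trans hts.1, hts.2.trans h2⟩)
  obtain ⟨z₁, hz₁, rfl⟩ := hlift x₁ hx₁q
  have h12 : w₁ ≤ w₂ := (hw₁t.trans hw₂t).le
  rcases lt_or_ge z₁.1.2 w₁ with hlt | hge
  · exact K.not_crossing H he hq hqe hx₀ hw₁S hw₁ hz₁ hz₀ hlt hw₁t (hout _ ⟨le_rfl, h12⟩)
      (hzx₀ ▸ hw₁)
  rcases lt_or_ge w₂ z₁.1.2 with hgt | hle
  · exact K.not_crossing H he hq hqe hx₀ hw₂S hw₂ hz₀ hz₁ hw₂t hgt (hzx₀ ▸ hw₂)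
      (hout _ ⟨h12, le_rfl⟩)
  exact hout _ ⟨hge, hle⟩ z₁.2

theorem bounded_edge (K : IsContourMap c₁ c₂ Q h V) (H : IsAdmissible c₁ c₂)
    (hb : ¬ BddBelow (criticalSet c₁ ∪ criticalSet c₂))
    (ha : ¬ BddAbove (criticalSet c₁ ∪ criticalSet c₂)) {e : Set R} (he : e ∈ edges V) :
    BddBelow (h '' e) ∧ BddAbove (h '' e) := by
  have := K.t2Space
  have hJ := ((K.isHeight H).isPreconnected_image_edge he).ordConnected
  obtain ⟨x₀, hx₀⟩ := (IsHeight.nonempty_edge he).image h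
  constructor <;> by_contra hcon
  · refine K.false_of_unbounded H hb ha he (q := Iic x₀) ordConnected_Iic (fun x hx => ?_)
      (mem_Iic.2 le_rfl) (fun Z hZ hxZ => ?_) fun M => ?_
    · obtain ⟨y, hy, hyx⟩ := not_bddBelow_iff.1 hcon x
      exact hJ.out hy hx₀ ⟨hyx.le, hx⟩
    · rintro ⟨y, hyZ, hy⟩ z hz
      by_contra hzx
      exact hxZ (hZ.out hyZ hz ⟨hy, (not_le.1 hzx).le⟩)
    · refine ⟨min x₀ (-(|M| + 1)), mem_Iic.2 (min_le_left _ _), ?_⟩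
      have := min_le_right x₀ (-(|M| + 1))
      have := neg_le_abs (min x₀ (-(|M| + 1)))
      linarith [le_abs_self M]
  · refine K.false_of_unbounded H hb ha he (q := Ici x₀) ordConnected_Ici (fun x hx => ?_)
      (mem_Ici.2 le_rfl) (fun Z hZ hxZ => ?_) fun M => ?_
    · obtain ⟨y, hy, hyx⟩ := not_bddAbove_iff.1 hcon x
      exact hJ.out hx₀ hy ⟨hx, hyx.le⟩
    · rintro ⟨y, hyZ, hy⟩ z hz
      by_contra hzx
      exact hxZ (hZ.out hz hyZ ⟨(not_le.1 hzx).le, hy⟩)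
    · refine ⟨max x₀ (|M| + 1), mem_Ici.2 (le_max_left _ _), ?_⟩
      have := le_max_right x₀ (|M| + 1)
      have := le_abs_self (max x₀ (|M| + 1))
      linarith [le_abs_self M]

theorem forall_edge_homeomorph_Icc_iff (K : IsContourMap c₁ c₂ Q h V) (H : IsAdmissible c₁ c₂) :
    (∀ e ∈ edges V, Nonempty (closure e ≃ₜ Icc (-1 : ℝ) 1)) ↔
      ¬ BddBelow (criticalSet c₁ ∪ criticalSet c₂) ∧
      ¬ BddAbove (criticalSet c₁ ∪ criticalSet c₂) := by
  have := K.t2Space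
  have HH := K.isHeight H
  constructor
  · intro hall
    constructor <;> intro hb
    · obtain ⟨e, he, hne⟩ := K.exists_unbounded_edge_of_bddBelow H hb
      exact hne ((HH.nonempty_homeomorph_Icc_iff he).1 (hall e he))
    · obtain ⟨e, he, hne⟩ := K.exists_unbounded_edge_of_bddAbove H hb
      exact hne ((HH.nonempty_homeomorph_Icc_iff he).1 (hall e he))
  · rintro ⟨hb, ha⟩ e he
    exact (HH.nonempty_homeomorph_Icc_iff he).2 (K.bounded_edge H hb ha he)

end IsContourMap

end Reeb

namespace Reeb

variable {c₁ c₂ : ℝ → ℝ} {m : ℕ}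

/-! ### The manifold over the strip -/

theorem apply_eq_of_mem_contour {X : Type*} [TopologicalSpace X] {f : X → ℝ} {x y : X}
    (hy : y ∈ contour f x) : f y = f x :=
  mem_singleton_iff.1 (mem_preimage.1 (connectedComponentIn_subset _ _ hy))

theorem closure_region (H : IsAdmissible c₁ c₂) : closure (region c₁ c₂) = strip c₁ c₂ := by
  refine Subset.antisymm
    (closure_minimal (fun z hz => ⟨hz.1.le, hz.2.le⟩) H.isClosed_strip) ?_
  rintro ⟨x, t⟩ hx
  have hx' : x ∈ closure (Ioo (c₁ t) (c₂ t)) := by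
    rw [closure_Ioo (H.lt t).ne]
    exact hx
  have hcont : Continuous fun y : ℝ => (y, t) := by fun_prop
  refine closure_mono ?_ (image_closure_subset_closure_image hcont ⟨x, hx', rfl⟩)
  rintro _ ⟨y, hy, rfl⟩
  exact hy

theorem mem_manifoldX_iff (H : IsAdmissible c₁ c₂) {p : Ambient m} :
    p ∈ manifoldX m c₁ c₂ ↔
      p.1 ∈ strip c₁ c₂ ∧ ‖p.2‖ ^ 2 = (p.1.1 - c₁ p.1.2) * (c₂ p.1.2 - p.1.1) := by
  rw [manifoldX, mem_ofPred_eq, closure_region H, EuclideanSpace.real_norm_sq_eq, sub_eq_zero,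
    eq_comm (a := (p.1.1 - c₁ p.1.2) * _)]

theorem isClosed_manifoldX (H : IsAdmissible c₁ c₂) : IsClosed (manifoldX m c₁ c₂) := by
  have h1 := H.smooth₁.continuous
  have h2 := H.smooth₂.continuous
  have : manifoldX m c₁ c₂ = {p | p.1 ∈ strip c₁ c₂} ∩
      {p | ‖p.2‖ ^ 2 = (p.1.1 - c₁ p.1.2) * (c₂ p.1.2 - p.1.1)} := by
    ext p
    exact mem_manifoldX_iff H
  rw [this]
  exact (H.isClosed_strip.preimage continuous_fst).inter
    (isClosed_eq (by fun_prop) (by fun_prop))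

/-- Bounded levels confine the parameter to a compact set, and then the defining equation bounds the
norm of `y`. -/
theorem isProperMap_proj (H : IsAdmissible c₁ c₂) :
    IsProperMap ((manifoldX m c₁ c₂).domRestrict (proj m)) := by
  have h1 := H.smooth₁.continuous
  have h2 := H.smooth₂.continuous
  have hcont : Continuous ((manifoldX m c₁ c₂).domRestrict (proj m)) :=
    (continuous_fst.comp continuous_fst).comp continuous_subtype_val
  refine isProperMap_iff_isCompact_preimage.2 ⟨hcont, fun K hK => ?_⟩
  obtain ⟨M, hM⟩ := hK.isBounded.exists_norm_le
  obtain ⟨T, hT, hTM⟩ := mem_cocompact.1 (H.eventually_escape M)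
  obtain ⟨B, hB⟩ := (hK.prod hT).exists_bound_of_continuousOn
    (f := fun z : ℝ × ℝ => (z.1 - c₁ z.2) * (c₂ z.2 - z.1)) (by fun_prop)
  have hC := (isClosed_manifoldX (m := m) H).isClosedEmbedding_subtypeVal.isCompact_preimage
    ((hK.prod hT).prod (isCompact_closedBall (0 : EuclideanSpace ℝ (Fin (m - 1))) √B))
  refine hC.of_isClosed_subset (hK.isClosed.preimage hcont) fun p hp => ?_
  obtain ⟨hps, hpn⟩ := (mem_manifoldX_iff H).1 p.2
  have hpK : p.1.1.1 ∈ K := hp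
  have hpT : p.1.1.2 ∈ T := by
    by_contra hcon
    exact hTM hcon p.1.1.1 (hM _ hpK) hps
  refine ⟨⟨hpK, hpT⟩, ?_⟩
  rw [mem_closedBall_zero_iff]
  refine Real.le_sqrt_of_sq_le ?_
  rw [hpn]
  exact (le_abs_self _).trans (hB p.1.1 ⟨hpK, hpT⟩)

/-- The section of the projection of the manifold onto the strip in the direction of a unit
vector. -/
noncomputable def lift (H : IsAdmissible c₁ c₂) {u : EuclideanSpace ℝ (Fin (m - 1))}
    (hu : ‖u‖ = 1) (z : strip c₁ c₂) : manifoldX m c₁ c₂ :=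
  ⟨(z.1, √((z.1.1 - c₁ z.1.2) * (c₂ z.1.2 - z.1.1)) • u), (mem_manifoldX_iff H).2 ⟨z.2, by
    rw [norm_smul, hu, mul_one, Real.norm_eq_abs, sq_abs, Real.sq_sqrt]
    exact mul_nonneg (sub_nonneg.2 z.2.1) (sub_nonneg.2 z.2.2)⟩⟩

theorem continuous_lift (H : IsAdmissible c₁ c₂) {u : EuclideanSpace ℝ (Fin (m - 1))}
    (hu : ‖u‖ = 1) : Continuous (lift H hu) := by
  have h1 := H.smooth₁.continuous
  have h2 := H.smooth₂.continuous
  unfold lift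
  fun_prop

/-- Every point of the manifold lies on a lift of the strip in the direction of a unit vector. -/
theorem exists_lift_eq (H : IsAdmissible c₁ c₂) {u : EuclideanSpace ℝ (Fin (m - 1))}
    (hu : ‖u‖ = 1) (p : manifoldX m c₁ c₂) (hp : p.1.1 ∈ strip c₁ c₂) :
    ∃ (v : EuclideanSpace ℝ (Fin (m - 1))) (hv : ‖v‖ = 1), lift H hv ⟨p.1.1, hp⟩ = p := by
  have hn := ((mem_manifoldX_iff H).1 p.2).2
  have hsq : √((p.1.1.1 - c₁ p.1.1.2) * (c₂ p.1.1.2 - p.1.1.1)) = ‖p.1.2‖ := by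
    rw [← hn, Real.sqrt_sq (norm_nonneg _)]
  by_cases h0 : p.1.2 = 0
  · refine ⟨u, hu, Subtype.ext (Prod.ext rfl ?_)⟩
    simp only [lift]
    rw [hsq, h0, norm_zero, zero_smul]
  · have hn0 : ‖p.1.2‖ ≠ 0 := norm_ne_zero_iff.2 h0
    refine ⟨‖p.1.2‖⁻¹ • p.1.2, ?_, Subtype.ext (Prod.ext rfl ?_)⟩
    · rw [norm_smul, norm_inv, norm_norm, inv_mul_cancel₀ hn0]
    · simp only [lift]
      rw [hsq, smul_inv_smul₀ hn0]

/-- From every point of a slice one can move left within the slice to a boundary point of the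
strip. -/
theorem exists_boundary_le (H : IsAdmissible c₁ c₂) {x t : ℝ} (ht : t ∈ slice c₁ c₂ x) :
    ∃ α ≤ t, Icc α t ⊆ slice c₁ c₂ x ∧ (x - c₁ α) * (c₂ α - x) = 0 := by
  have h1 := H.smooth₁.continuous
  have h2 := H.smooth₂.continuous
  set S := {s | s ≤ t ∧ (x ≤ c₁ s ∨ c₂ s ≤ x)}
  have hSne : S.Nonempty := by
    obtain ⟨s, hs, hsx⟩ := H.exists_le_notMem_slice x t
    refine ⟨s, hs, ?_⟩
    by_contra! hcon
    exact hsx ⟨hcon.1.le, hcon.2.le⟩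
  have hSb : BddAbove S := ⟨t, fun s hs => hs.1⟩
  have hScl : IsClosed S := (isClosed_le continuous_id continuous_const).inter
    ((isClosed_le continuous_const h1).union (isClosed_le h2 continuous_const))
  have hα := hScl.csSup_mem hSne hSb
  set α := sSup S
  have hIoc : Ioc α t ⊆ slice c₁ c₂ x := by
    intro s hs
    by_contra hsx
    refine (le_csSup hSb (⟨hs.2, ?_⟩ : s ∈ S)).not_gt hs.1
    by_contra! hcon
    exact hsx ⟨hcon.1.le, hcon.2.le⟩
  have hIcc : Icc α t ⊆ slice c₁ c₂ x := by
    rcases hα.1.eq_or_lt with h | h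
    · rw [h, Icc_self]
      exact singleton_subset_iff.2 ht
    · rw [← closure_Ioc h.ne]
      exact (H.isClosed_slice x).closure_subset_iff.2 hIoc
  have hαx := hIcc (left_mem_Icc.2 hα.1)
  refine ⟨α, hα.1, hIcc, ?_⟩
  rcases hα.2 with h | h
  · rw [le_antisymm h hαx.1, sub_self, zero_mul]
  · rw [le_antisymm h hαx.2, sub_self, mul_zero]

/-- Lifts of a slice interval in the directions of two unit vectors meet over a boundary point,
where the radius is zero. Extending the interval left to such a point joins `p` to `p'` without
using connectedness of the sphere, which fails for `m = 2`. -/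
theorem mem_contour_of_le (H : IsAdmissible c₁ c₂) {u : EuclideanSpace ℝ (Fin (m - 1))}
    (hu : ‖u‖ = 1) {p p' : manifoldX m c₁ c₂} (hx : p.1.1.1 = p'.1.1.1)
    (ht : p.1.1.2 ≤ p'.1.1.2) (hsub : Icc p.1.1.2 p'.1.1.2 ⊆ slice c₁ c₂ p.1.1.1) :
    ∃ C : Set (manifoldX m c₁ c₂), IsPreconnected C ∧ p ∈ C ∧ p' ∈ C ∧
      C ⊆ (manifoldX m c₁ c₂).domRestrict (proj m) ⁻¹' {p.1.1.1} := by
  have hps := ((mem_manifoldX_iff H).1 p.2).1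
  have hps' := ((mem_manifoldX_iff H).1 p'.2).1
  obtain ⟨α, hα, hαsub, hα0⟩ := exists_boundary_le H (mem_slice_iff.2 hps)
  obtain ⟨v, hv, hpv⟩ := exists_lift_eq H hu p hps
  obtain ⟨v', hv', hpv'⟩ := exists_lift_eq H hu p' hps'
  set x := p.1.1.1
  have hI : Icc α p'.1.1.2 ⊆ slice c₁ c₂ x := by
    rw [← Icc_union_Icc_eq_Icc hα ht]
    exact union_subset hαsub hsub
  have : PreconnectedSpace (Icc α p'.1.1.2) := Subtype.preconnectedSpace isPreconnected_Icc
  set j : Icc α p'.1.1.2 → strip c₁ c₂ := fun s => ⟨(x, s), hI s.2⟩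
  have hj : Continuous j := by fun_prop
  have hC : IsPreconnected (range (lift H hv ∘ j)) :=
    isPreconnected_range ((continuous_lift H hv).comp hj)
  have hC' : IsPreconnected (range (lift H hv' ∘ j)) :=
    isPreconnected_range ((continuous_lift H hv').comp hj)
  have hα' : α ∈ Icc α p'.1.1.2 := ⟨le_rfl, hα.trans ht⟩
  have hmeet : (lift H hv ∘ j) ⟨α, hα'⟩ = (lift H hv' ∘ j) ⟨α, hα'⟩ := by
    refine Subtype.ext (Prod.ext rfl ?_)
    simp only [Function.comp, lift, j]
    rw [hα0, Real.sqrt_zero, zero_smul, zero_smul]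
  have hpm : (lift H hv ∘ j) ⟨p.1.1.2, hα, ht⟩ = p := hpv
  have hpm' : (lift H hv' ∘ j) ⟨p'.1.1.2, hα.trans ht, le_rfl⟩ = p' := by
    refine Eq.trans (congrArg (lift H hv') ?_) hpv'
    exact Subtype.ext (Prod.ext hx rfl)
  refine ⟨range (lift H hv ∘ j) ∪ range (lift H hv' ∘ j),
    hC.union _ (mem_range_self ⟨α, hα'⟩) ⟨⟨α, hα'⟩, hmeet.symm⟩ hC',
    .inl ⟨_, hpm⟩, .inr ⟨_, hpm'⟩, ?_⟩
  rintro _ (⟨s, rfl⟩ | ⟨s, rfl⟩) <;> rfl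

/-- Two points of the manifold lie in the same contour exactly when they have the same level and
their parameters lie in the same component of the slice. -/
theorem quotientMap_eq_iff (H : IsAdmissible c₁ c₂) {u : EuclideanSpace ℝ (Fin (m - 1))}
    (hu : ‖u‖ = 1) (p p' : manifoldX m c₁ c₂) :
    quotientMap ((manifoldX m c₁ c₂).domRestrict (proj m)) p =
        quotientMap ((manifoldX m c₁ c₂).domRestrict (proj m)) p' ↔
      p.1.1.1 = p'.1.1.1 ∧ uIcc p.1.1.2 p'.1.1.2 ⊆ slice c₁ c₂ p.1.1.1 := by
  set f := (manifoldX m c₁ c₂).domRestrict (proj m)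
  have hq : quotientMap f p = quotientMap f p' ↔ contour f p = contour f p' := Quotient.eq
  rw [hq]
  constructor
  · intro heq
    have hp' : p' ∈ contour f p := heq ▸ mem_connectedComponentIn rfl
    have hp : p ∈ contour f p := mem_connectedComponentIn rfl
    have hx : p.1.1.1 = p'.1.1.1 := (apply_eq_of_mem_contour (f := f) hp').symm
    refine ⟨hx, ?_⟩
    have hc : IsPreconnected ((fun y : manifoldX m c₁ c₂ => y.1.1.2) '' contour f p) :=
      isPreconnected_connectedComponentIn.image _ (by fun_prop)
    refine (hc.ordConnected.uIcc_subset ⟨p, hp, rfl⟩ ⟨p', hp', rfl⟩).trans ?_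
    rintro _ ⟨y, hy, rfl⟩
    have hyx : y.1.1.1 = p.1.1.1 := apply_eq_of_mem_contour (f := f) hy
    rw [← hyx]
    exact ((mem_manifoldX_iff H).1 y.2).1
  · rintro ⟨hx, hsub⟩
    have hff : f p' = f p := hx.symm
    obtain ⟨C, hC, hpC, hpC', hCs⟩ : ∃ C : Set (manifoldX m c₁ c₂), IsPreconnected C ∧ p ∈ C ∧
        p' ∈ C ∧ C ⊆ f ⁻¹' {f p} := by
      rcases le_total p.1.1.2 p'.1.1.2 with hle | hle
      · rw [uIcc_of_le hle] at hsub
        exact mem_contour_of_le H hu hx hle hsub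
      · rw [uIcc_of_ge hle, hx] at hsub
        obtain ⟨C, h1, h2, h3, h4⟩ := mem_contour_of_le H hu hx.symm hle hsub
        exact ⟨C, h1, h3, h2, hff ▸ h4⟩
    have := connectedComponentIn_eq (hC.subset_connectedComponentIn hpC hCs hpC')
    rw [contour, contour, hff]
    exact this

/-! ### Critical points of the projection -/

/-- Along any curve in the manifold `x - c₁ t ≥ 0`, with equality at a lower boundary point, so its
derivative vanishes there; as `c₁' = 0`, this derivative is that of `x`. The upper boundary is
symmetric. -/
theorem isCriticalPointOn_of_isCriticalAt (H : IsAdmissible c₁ c₂) {p : Ambient m}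
    (hp : p ∈ manifoldX m c₁ c₂) (h : IsCriticalAt c₁ c₂ p.1.1 p.1.2) :
    IsCriticalPointOn (manifoldX m c₁ c₂) (proj m) p := by
  refine ⟨hp, fun ε γ hε hγ hγX hγ0 => ?_⟩
  have hnhds : Ioo (-ε) ε ∈ 𝓝 (0 : ℝ) := Ioo_mem_nhds (by linarith) hε
  have hd : HasDerivAt γ (deriv γ 0) 0 :=
    ((hγ.contDiffAt hnhds).differentiableAt (by simp)).hasDerivAt
  have hx : HasDerivAt (fun s => (γ s).1.1) (deriv γ 0).1.1 0 := hd.fst.fst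
  have ht : HasDerivAt (fun s => (γ s).1.2) (deriv γ 0).1.2 0 := hd.fst.snd
  have hgoal : deriv (fun s => proj m (γ s)) 0 = (deriv γ 0).1.1 := hx.deriv
  have hmem : ∀ᶠ s in 𝓝 (0 : ℝ), (γ s).1 ∈ strip c₁ c₂ := by
    filter_upwards [hnhds] with s hs
    exact ((mem_manifoldX_iff H).1 (hγX s hs)).1
  rw [hgoal]
  rcases h with ⟨hcr, hval⟩ | ⟨hcr, hval⟩
  · have hc : HasDerivAt c₁ 0 (γ 0).1.2 := by
      rw [hγ0, ← (hcr : deriv c₁ p.1.2 = 0)]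
      exact (H.smooth₁.differentiable (by simp) _).hasDerivAt
    have hφ := hx.sub (hc.comp 0 ht)
    have hmin : IsLocalMin ((fun s => (γ s).1.1) - c₁ ∘ fun s => (γ s).1.2) 0 := by
      filter_upwards [hmem] with s hs
      simp only [Pi.sub_apply, Function.comp, hγ0, hval, sub_self]
      linarith [hs.1]
    simpa using hmin.hasDerivAt_eq_zero hφ
  · have hc : HasDerivAt c₂ 0 (γ 0).1.2 := by
      rw [hγ0, ← (hcr : deriv c₂ p.1.2 = 0)]
      exact (H.smooth₂.differentiable (by simp) _).hasDerivAt
    have hφ := hx.sub (hc.comp 0 ht)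
    have hmax : IsLocalMax ((fun s => (γ s).1.1) - c₂ ∘ fun s => (γ s).1.2) 0 := by
      filter_upwards [hmem] with s hs
      simp only [Pi.sub_apply, Function.comp, hγ0, hval, sub_self]
      linarith [hs.2]
    simpa using hmax.hasDerivAt_eq_zero hφ

/-- At a point off the boundary of the strip the projection is not critical. -/
theorem snd_eq_zero_of_isCriticalPointOn (H : IsAdmissible c₁ c₂) {p : Ambient m}
    (h : IsCriticalPointOn (manifoldX m c₁ c₂) (proj m) p) : p.2 = 0 := by
  by_contra hy
  obtain ⟨⟨⟨x, t⟩, y⟩, hp, hcrit⟩ : ∃ q, q ∈ manifoldX m c₁ c₂ ∧ q = p := ⟨p, h.1, rfl⟩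
  subst hcrit
  obtain ⟨hps, hpn⟩ := (mem_manifoldX_iff H).1 hp
  simp only at hps hpn hy
  have hn0 : 0 < ‖y‖ := norm_pos_iff.2 hy
  have hpos : 0 < (x - c₁ t) * (c₂ t - x) := hpn ▸ pow_pos hn0 2
  have h1 : 0 < x - c₁ t :=
    lt_of_le_of_ne (sub_nonneg.2 hps.1) fun h => by rw [← h, zero_mul] at hpos; exact hpos.false
  have h2 : 0 < c₂ t - x :=
    lt_of_le_of_ne (sub_nonneg.2 hps.2) fun h => by rw [← h, mul_zero] at hpos; exact hpos.false
  set ε := min (x - c₁ t) (c₂ t - x)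
  have hε : 0 < ε := lt_min h1 h2
  have hbound : ∀ s ∈ Ioo (-ε) ε, 0 < x + s - c₁ t ∧ 0 < c₂ t - (x + s) := fun s hs =>
    ⟨by linarith [hs.1, min_le_left (x - c₁ t) (c₂ t - x)],
      by linarith [hs.2, min_le_right (x - c₁ t) (c₂ t - x)]⟩
  -- Move `x` at unit speed with `t` fixed and rescale `y` to satisfy the equation; the radius is
  -- smooth since it stays positive.
  set γ : ℝ → Ambient m :=
    fun s => ((x + s, t), (√((x + s - c₁ t) * (c₂ t - (x + s))) * ‖y‖⁻¹) • y)
  have hsm : ContDiffOn ℝ ∞ γ (Ioo (-ε) ε) := by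
    have hsq : ContDiffOn ℝ ∞ (fun s => √((x + s - c₁ t) * (c₂ t - (x + s)))) (Ioo (-ε) ε) :=
      ContDiffOn.sqrt (by fun_prop) fun s hs => (mul_pos (hbound s hs).1 (hbound s hs).2).ne'
    have hx : ContDiffOn ℝ ∞ (fun s : ℝ => ((x + s, t) : ℝ × ℝ)) (Ioo (-ε) ε) := by fun_prop
    exact hx.prodMk ((hsq.mul contDiffOn_const).smul contDiffOn_const)
  have hγX : ∀ s ∈ Ioo (-ε) ε, γ s ∈ manifoldX m c₁ c₂ := by
    intro s hs
    obtain ⟨hb1, hb2⟩ := hbound s hs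
    refine (mem_manifoldX_iff H).2 ⟨⟨(sub_pos.1 hb1).le, (sub_pos.1 hb2).le⟩, ?_⟩
    simp only [γ]
    rw [norm_smul, norm_mul, norm_inv, norm_norm, mul_assoc, inv_mul_cancel₀ hn0.ne', mul_one,
      Real.norm_eq_abs, sq_abs, Real.sq_sqrt (mul_pos hb1 hb2).le]
  have hγ0 : γ 0 = ((x, t), y) := by
    simp only [γ, add_zero]
    rw [← hpn, Real.sqrt_sq hn0.le, mul_inv_cancel₀ hn0.ne', one_smul]
  have hzero := h.2 ε γ hε hsm hγX hγ0
  have hone : HasDerivAt (fun s => proj m (γ s)) 1 0 := by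
    simpa [proj, γ] using (hasDerivAt_id (0 : ℝ)).const_add x
  rw [hone.deriv] at hzero
  exact one_ne_zero hzero

/-- With `y = 0` the point lies over the boundary of the strip, and the boundary graph itself is a
test curve in the manifold. -/
theorem isCriticalAt_of_isCriticalPointOn (H : IsAdmissible c₁ c₂) {p : Ambient m}
    (h : IsCriticalPointOn (manifoldX m c₁ c₂) (proj m) p) :
    IsCriticalAt c₁ c₂ p.1.1 p.1.2 := by
  have hy := snd_eq_zero_of_isCriticalPointOn H h
  obtain ⟨hps, hpn⟩ := (mem_manifoldX_iff H).1 h.1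
  have key : ∀ c : ℝ → ℝ, ContDiff ℝ ∞ c → (∀ s, (c s, s) ∈ strip c₁ c₂) →
      (∀ s, (c s - c₁ s) * (c₂ s - c s) = 0) → c p.1.2 = p.1.1 → p.1.2 ∈ criticalSet c := by
    intro c hc hcs hc0 hcp
    have hzero := h.2 1 (fun s => ((c (p.1.2 + s), p.1.2 + s), 0)) one_pos
      (ContDiff.contDiffOn (by fun_prop))
      (fun s _ => (mem_manifoldX_iff H).2 ⟨hcs _, by simp [hc0]⟩)
      (Prod.ext (Prod.ext (by simp [hcp]) (by simp)) hy.symm)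
    simp only [proj] at hzero
    rw [deriv_comp_const_add] at hzero
    simpa [criticalSet] using hzero
  rw [hy, norm_zero, zero_pow two_ne_zero, eq_comm, mul_eq_zero, sub_eq_zero, sub_eq_zero] at hpn
  rcases hpn with hx | hx
  · exact .inl ⟨key c₁ H.smooth₁ (fun s => ⟨le_rfl, (H.lt s).le⟩) (by simp) hx.symm, hx.symm⟩
  · exact .inr ⟨key c₂ H.smooth₂ (fun s => ⟨(H.lt s).le, le_rfl⟩) (by simp) hx, hx⟩

/-! ### The Reeb space as a quotient of the strip -/

/-- The height function on the Reeb space. -/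
def height {X : Type*} [TopologicalSpace X] (f : X → ℝ) : ReebSpace f → ℝ :=
  Quotient.lift f fun x y hxy => by
    have hx : x ∈ contour f x := mem_connectedComponentIn rfl
    have heq : contour f x = contour f y := hxy
    rw [heq] at hx
    exact apply_eq_of_mem_contour hx

theorem isContourMap (H : IsAdmissible c₁ c₂) {u : EuclideanSpace ℝ (Fin (m - 1))}
    (hu : ‖u‖ = 1) :
    IsContourMap c₁ c₂
      (fun z => quotientMap ((manifoldX m c₁ c₂).domRestrict (proj m)) (lift H hu z))
      (height ((manifoldX m c₁ c₂).domRestrict (proj m)))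
      (criticalContours (manifoldX m c₁ c₂) (proj m)) := by
  set f := (manifoldX m c₁ c₂).domRestrict (proj m)
  set pr : manifoldX m c₁ c₂ → strip c₁ c₂ :=
    fun p => ⟨p.1.1, ((mem_manifoldX_iff H).1 p.2).1⟩
  have hpr : Continuous pr := by fun_prop
  have hqq : IsQuotientMap (quotientMap f) := isQuotientMap_quotient_mk'
  have hfac : ∀ p, quotientMap f (lift H hu (pr p)) = quotientMap f p := fun p =>
    (quotientMap_eq_iff H hu _ _).2 ⟨rfl, by
      change uIcc p.1.1.2 p.1.1.2 ⊆ _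
      rw [uIcc_self]
      exact singleton_subset_iff.2 (pr p).2⟩
  have hcont : Continuous fun z => quotientMap f (lift H hu z) :=
    hqq.continuous.comp (continuous_lift H hu)
  refine ⟨?_, fun z z' => quotientMap_eq_iff H hu _ _, fun z => rfl, fun r => ⟨?_, ?_⟩⟩
  -- The quotient map of the manifold factors through the projection to the strip, so the second
  -- factor is a quotient map too.
  · refine IsQuotientMap.of_comp hpr hcont ?_
    have : (fun z => quotientMap f (lift H hu z)) ∘ pr = quotientMap f := funext hfac
    rw [this]
    exact hqq
  · rintro ⟨p, hp, rfl⟩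
    exact ⟨pr p, hfac p, isCriticalAt_of_isCriticalPointOn H hp⟩
  · rintro ⟨z, rfl, hz⟩
    exact ⟨lift H hu z, isCriticalPointOn_of_isCriticalAt H (lift H hu z).2 hz, rfl⟩

/-! ### The hypotheses on the two functions -/

theorem exists_isolating {S : Set ℝ} (hc : IsClosed S) (hd : IsDiscrete S) (a : ℝ) :
    ∃ δ > 0, ∀ y ∈ S, y ∈ Ioo (a - δ) (a + δ) → y = a := by
  have h := isClosed_and_discrete_iff.1 ⟨hc, hd⟩ a
  rw [disjoint_principal_right, mem_nhdsWithin] at h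
  obtain ⟨U, hU, haU, hsub⟩ := h
  obtain ⟨δ, hδ, hball⟩ := Metric.isOpen_iff.1 hU a haU
  rw [Real.ball_eq_Ioo] at hball
  refine ⟨δ, hδ, fun y hy hya => ?_⟩
  by_contra hne
  exact hsub ⟨hball hya, hne⟩ hy

theorem eventually_escape_of_tendsto {l : Filter ℝ}
    (h : (Tendsto c₁ l atTop ∧ Tendsto c₂ l atTop) ∨ (Tendsto c₁ l atBot ∧ Tendsto c₂ l atBot))
    (M : ℝ) : ∀ᶠ t in l, M < c₁ t ∨ c₂ t < -M := by
  rcases h with h | h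
  · filter_upwards [h.1.eventually_gt_atTop M] with t ht using .inl ht
  · filter_upwards [h.2.eventually_lt_atBot (-M)] with t ht using .inr ht

end Reeb

theorem theorem4 (m : ℕ) (hm : 2 ≤ m) (c₁ c₂ : ℝ → ℝ)
    (hc₁ : ContDiff ℝ ∞ c₁) (hc₂ : ContDiff ℝ ∞ c₂) (hlt : ∀ t, c₁ t < c₂ t)
    (hclosed : IsClosed (c₁ '' Reeb.criticalSet c₁ ∪ c₂ '' Reeb.criticalSet c₂))
    (hdiscrete : IsDiscrete (c₁ '' Reeb.criticalSet c₁ ∪ c₂ '' Reeb.criticalSet c₂))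
    (hcrit : (Reeb.criticalSet c₁ ∪ Reeb.criticalSet c₂).Nonempty)
    (hleft : (Tendsto c₁ atBot atTop ∧ Tendsto c₂ atBot atTop) ∨
      (Tendsto c₁ atBot atBot ∧ Tendsto c₂ atBot atBot))
    (hright : (Tendsto c₁ atTop atTop ∧ Tendsto c₂ atTop atTop) ∨
      (Tendsto c₁ atTop atBot ∧ Tendsto c₂ atTop atBot)) :
    IsProperMap ((Reeb.manifoldX m c₁ c₂).domRestrict (Reeb.proj m)) ∧
    Reeb.IsGraphWithEnds (Reeb.ReebSpace ((Reeb.manifoldX m c₁ c₂).domRestrict (Reeb.proj m)))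
      (Reeb.criticalContours (Reeb.manifoldX m c₁ c₂) (Reeb.proj m)) ∧
    (Reeb.IsIsomorphicToGraph
        (Reeb.ReebSpace ((Reeb.manifoldX m c₁ c₂).domRestrict (Reeb.proj m)))
        (Reeb.criticalContours (Reeb.manifoldX m c₁ c₂) (Reeb.proj m)) ↔
      ¬ BddBelow (Reeb.criticalSet c₁ ∪ Reeb.criticalSet c₂) ∧
      ¬ BddAbove (Reeb.criticalSet c₁ ∪ Reeb.criticalSet c₂)) := by
  have H : Reeb.IsAdmissible c₁ c₂ := by
    refine ⟨hc₁, hc₂, hlt, fun M => ?_, Reeb.exists_isolating hclosed hdiscrete⟩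
    rw [cocompact_eq_atBot_atTop, eventually_sup]
    exact ⟨Reeb.eventually_escape_of_tendsto hleft M, Reeb.eventually_escape_of_tendsto hright M⟩
  -- The condition `m ≥ 2` enters here: it provides a unit vector, hence a section over the strip.
  have hu : ‖EuclideanSpace.single (⟨0, by omega⟩ : Fin (m - 1)) (1 : ℝ)‖ = 1 := by simp
  have K := Reeb.isContourMap H hu
  have hG := K.isGraphWithEnds H hcrit
  exact ⟨Reeb.isProperMap_proj H, hG,
    (Reeb.isIsomorphicToGraph_iff hG).trans (K.forall_edge_homeomorph_Icc_iff H)⟩
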